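/- Order $\{0,1\}^r$ coordinatewise and write $|x|$ for the Hamming weight of $x$. For disjoint $A,B\subseteq\{0,1\}^r$, a monotone matching from $A$ to $B$ is a set of pairs $(x,y)\in A\times B$ with $x<y$, no two of which share a vertex; it is perfect if it covers $A\cup B$. For $m\ge 1$ let $[m]=\{0,\dots,m-1\}$. For $\delta>0$, a map $\phi:\{0,1\}^r\to[m]$ with classes $A_i=\phi^{-1}(i)$ admits a $\delta$-almost perfect matching if for every $0\le i\le m-2$ there is a monotone matching from $A_i$ to $A_{i+1}$ that leaves at most $\delta|A_i|$ vertices of $A_i$ and at most $\delta|A_{i+1}|$ vertices of $A_{i+1}$ uncovered. A layer ordering is a bijection $\pi:\{0,1\}^r\to\{1,\dots,2^r\}$ with $\pi(x)<\pi(y)$ whenever $|x|<|y|$. Put $N=\lfloor 2^r/m\rfloor$ and $P_i(\pi)=\pi^{-1}(\{N(i-1)+1,\dots,Ni\})$ for $1\le i\le m$. **Theorem.** There are an absolute constant $C>0$ and a function $\eta:\mathbb N\to\mathbb R$ with $\eta(r)\to0$ as $r\to\infty$ such that for all integers $m\ge1$ and $r\ge C m^6$ the following hold. 1. There is a monotone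 $\phi:\{0,1\}^r\to[m]$ that admits a $\delta$-almost perfect matching for some $0<\delta\le m2^{-r}$. 2. There are sets $P_1,\dots,P_m\subseteq\{0,1\}^r$, of the form $P_i=P_i(\pi)$ for some layer ordering $\pi$, such that (a) $P_i\cap P_j=\emptyset$ for $i\ne j$; (b) $|P_i|=\lfloor 2^r/m\rfloor$ for all $i$; (c) $|x|\le|y|$ whenever $x\in P_i$ and $y\in P_{i+1}$, and whenever $x\in\bigcup_i P_i$ and $y\notin\bigcup_i P_i$; (d) for each $1\le i\le m-1$ there is a monotone perfect matching from $P_i$ to $P_{i+1}$. Moreover, the map $\phi$ given by $\phi(x)=i-1$ for $x\in P_i$ and $\phi(x)=m-1$ for $x\notin\bigcup_iP_i$ is monotone, and for each $0\le i\le m-2$ there is a monotone matching from $\phi^{-1}(i)$ to $\phi^{-1}(i+1)$ that covers all vertices of these two classes, except possibly at most $m-1$ vertices of $\phi^{-1}(m-1)$ when $i=m-2$ (hence the uncovered vertices form a fraction less than $m2^{-r}$ of the cube). 3. If $\pi$ is chosen uniformly at random among all layer orderings (that is, each Hamming layer is ordered uniformly at random, independently), then with probability at least $1-\eta(r)$ the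 sets $P_1(\pi),\dots,P_m(\pi)$ satisfy (a)–(d). -/

import Mathlib

open Filter Topology

namespace CubeMatching

/-- The Boolean cube `{0,1}^n` with the coordinatewise order (`false < true`). -/
abbrev Cube (n : ℕ) : Type := Fin n → Bool

/-- Hamming weight `|x|`. -/
def weight {n : ℕ} (x : Cube n) : ℕ := (Finset.univ.filter fun i => x i = true).card

/-- `E` is a matching between `A` and `B` in the directed graph on the cube whose edges are
the pairs `(x, y)` with `x < y`; edges go from `A` up to `B` and no two of them share an endpoint
(it is only used for disjoint `A` and `B`). -/
structure IsMonotoneMatching {n : ℕ} (A B : Finset (Cube n)) (E : Finset (Cube n × Cube n)) :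
    Prop where
  edge : ∀ e ∈ E, e.1 ∈ A ∧ e.2 ∈ B ∧ e.1 < e.2
  inj_left : ∀ e ∈ E, ∀ f ∈ E, e.1 = f.1 → e = f
  inj_right : ∀ e ∈ E, ∀ f ∈ E, e.2 = f.2 → e = f

/-- There is a monotone matching from `A` to `B` covering every vertex of `A` and of `B`. -/
def HasPerfectMonotoneMatching {n : ℕ} (A B : Finset (Cube n)) : Prop :=
  ∃ E : Finset (Cube n × Cube n),
    IsMonotoneMatching A B E ∧ E.image Prod.fst = A ∧ E.image Prod.snd = B

/-- The class `A_i = {x | φ x = i}`. -/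
def fiber {n m : ℕ} (φ : Cube n → Fin m) (i : Fin m) : Finset (Cube n) :=
  Finset.univ.filter fun x => φ x = i

/-- For every two consecutive classes `A_i`, `A_{i+1}` of `φ` there is a monotone matching between
them which leaves at most `b i` vertices of `A_i` and at most `b (i+1)` vertices of `A_{i+1}`
uncovered. -/
def AdmitsMatchingsMissing {n m : ℕ} (φ : Cube n → Fin m) (b : Fin m → ℝ) : Prop :=
  ∀ i j : Fin m, (i : ℕ) + 1 = (j : ℕ) →
    ∃ E : Finset (Cube n × Cube n),
      IsMonotoneMatching (fiber φ i) (fiber φ j) E ∧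
      ((fiber φ i \ E.image Prod.fst).card : ℝ) ≤ b i ∧
      ((fiber φ j \ E.image Prod.snd).card : ℝ) ≤ b j

/-- `φ` admits a `δ`-almost perfect matching: each matching `E_i` between `A_i` and `A_{i+1}`
covers all but a `δ` fraction of the vertices of `A_i` and all but a `δ` fraction of those of
`A_{i+1}`. -/
def AdmitsAlmostPerfectMatching {n m : ℕ} (δ : ℝ) (φ : Cube n → Fin m) : Prop :=
  AdmitsMatchingsMissing φ fun i => δ * ((fiber φ i).card : ℝ)

/-- Sets `P_1, …, P_m` (indexed from `0` here) that are disjoint, of size `⌊2^n / m⌋`, ordered by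
Hamming weight (also below all remaining points), and consecutively perfectly matched. -/
structure IsMatchedFamily {n m : ℕ} (P : Fin m → Finset (Cube n)) : Prop where
  disjoint : ∀ i j : Fin m, i ≠ j → Disjoint (P i) (P j)
  card_eq : ∀ i : Fin m, (P i).card = 2 ^ n / m
  weight_le : ∀ i j : Fin m, (i : ℕ) + 1 = (j : ℕ) →
    ∀ x ∈ P i, ∀ y ∈ P j, weight x ≤ weight y
  weight_le_rest : ∀ i : Fin m, ∀ x ∈ P i, ∀ y : Cube n, (∀ j : Fin m, y ∉ P j) →
    weight x ≤ weight y
  matched : ∀ i j : Fin m, (i : ℕ) + 1 = (j : ℕ) → HasPerfectMonotoneMatching (P i) (P j)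

/-- The orderings of the cube that list the Hamming layers in increasing order of weight and are
arbitrary inside each layer. A uniformly random element of this set is the same thing as
independent uniformly random orderings of the layers. -/
def layerOrderings (n : ℕ) : Set (Cube n ≃ Fin (2 ^ n)) :=
  {π | ∀ x y : Cube n, weight x < weight y → π x < π y}

/-- The `i`-th consecutive block (`i = 0, …, m - 1`) of `⌊2^n / m⌋` points in the ordering `π`. -/
def chunk {n : ℕ} (m : ℕ) (π : Cube n ≃ Fin (2 ^ n)) (i : Fin m) : Finset (Cube n) :=
  Finset.univ.filter fun x =>
    2 ^ n / m * (i : ℕ) ≤ (π x : ℕ) ∧ (π x : ℕ) < 2 ^ n / m * ((i : ℕ) + 1)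

end CubeMatching

/-! Fix consecutive blocks `P`, `Q` of a layer ordering, separated at a point of weight `b`. Hall's
condition for monotone matchings reduces to `|U ∩ P| ≤ |U ∩ Q|` for every up-set `U`
(`exists_matching_of_upperSet`). The density of `U` in the layers is nondecreasing (`density_mono`),
while `P` lies in layers up to `b` and `Q` in layers from `b` on. If both met every layer in a
representative set, the inequality would follow by averaging. The work lies in the layers that are
cut by a block boundary.

In a random ordering, concentration and a union bound make every initial segment contain about the
expected proportion of every large neighbourhood (`card_not_wellSpread_le`). Neighbourhoods ten
layers away are used: near the middle of the cube they have at least `32 * n ^ 9` points, enough to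
beat exponentially many events. Double counting (`card_inter_le_of_biregular`) then compares `U` on
a cut layer with its density ten layers away.

Put `M`, `M'` for the densities of `U` in the layers `b - 10`, `b + 10` and `Δ = M' - M`. The main
gain is `|P| * Δ`. The layers within about twenty of `b` lose at most a constant number of layer
sizes times `Δ`, which is small since a layer has at most `2 ^ n / √n` points. The sampling error is
proportional to `min M (1 - M) + Δ`, and edge expansion of up-sets, `Δ ≥ M * (1 - M) / n ^ 2`
(`density_succ_ge`), absorbs it. If `U` meets `P` and omits a point of `Q`, the net gain is even at
least `m` (`gain_ge`, `Setting.card_inter_add_le`); this surplus pays for the fewer than `m` points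
left over by division. Otherwise Hall's condition is trivial. -/

namespace CubeMatching

/-! ### Double counting in biregular bipartite graphs -/

/-- In a biregular bipartite graph between `X` and `Y`, let `P ⊆ X` occupy a fraction close to `p`
of each neighbourhood of a vertex of `Y`, and let `UX` have all its neighbours in `UY`. Then
`UX ∩ P` is not much larger than `P` times the density of `UY`. -/
theorem card_inter_le_of_biregular {α β : Type*} [DecidableEq α] [DecidableEq β]
    (X P UX : Finset α) (Y UY : Finset β) (R : α → β → Prop) [∀ x y, Decidable (R x y)]
    {D D' : ℕ} {p ε M : ℝ} (hD : 0 < D)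
    (hX : ∀ x ∈ X, (Y.filter fun y => R x y).card = D)
    (hY : ∀ y ∈ Y, (X.filter fun x => R x y).card = D')
    (hPX : P ⊆ X) (hp : (P.card : ℝ) = p * X.card)
    (hconc : ∀ y ∈ Y, |((P.filter fun x => R x y).card : ℝ) - p * D'| ≤ ε * D')
    (hε : 0 ≤ ε) (hUY : UY ⊆ Y)
    (hU : ∀ x ∈ X, ∀ y ∈ Y, R x y → x ∈ UX → y ∈ UY)
    (hM : (UY.card : ℝ) ≤ M * Y.card) (hM1 : M ≤ 1) :
    ((UX ∩ P).card : ℝ) ≤ P.card * M + ε * X.card * min M (1 - M) := by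
  have hD0 : (0 : ℝ) < D := by exact_mod_cast hD
  have total : (X.card : ℝ) * D = Y.card * D' := by
    have h := Finset.sum_card_bipartiteAbove_eq_sum_card_bipartiteBelow (s := X) (t := Y) R
    simp only [Finset.bipartiteAbove, Finset.bipartiteBelow] at h
    rw [Finset.sum_congr rfl hX, Finset.sum_congr rfl hY] at h
    simp only [Finset.sum_const, smul_eq_mul] at h
    exact_mod_cast h
  have hP0 : 0 ≤ p * (X.card : ℝ) := hp ▸ Nat.cast_nonneg _
  have hXn : (0 : ℝ) ≤ X.card := Nat.cast_nonneg _
  have hpe : 0 ≤ (p + ε) * (X.card : ℝ) := by nlinarith [mul_nonneg hε hXn]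
  -- Counting the edges at `UX ∩ P`, all of which end in `UY`, gives an error proportional to `M`.
  have up : ((UX ∩ P).card : ℝ) ≤ (p + ε) * X.card * M := by
    have h := Finset.sum_card_bipartiteAbove_eq_sum_card_bipartiteBelow
      (s := UX ∩ P) (t := UY) R
    have h1 : ∀ x ∈ UX ∩ P, (UY.bipartiteAbove R x).card = D := by
      intro x hx
      rw [Finset.mem_inter] at hx
      rw [← hX x (hPX hx.2)]
      congr 1
      ext y
      simp only [Finset.mem_bipartiteAbove, Finset.mem_filter]
      exact ⟨fun hy => ⟨hUY hy.1, hy.2⟩, fun hy => ⟨hU x (hPX hx.2) y hy.1 hy.2 hx.1, hy.2⟩⟩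
    rw [Finset.sum_congr rfl h1, Finset.sum_const, smul_eq_mul] at h
    have h2 : ∀ y ∈ UY, (((UX ∩ P).bipartiteBelow R y).card : ℝ) ≤ (p + ε) * D' := by
      intro y hy
      have := (abs_le.1 (hconc y (hUY hy))).2
      have h3 : ((UX ∩ P).bipartiteBelow R y).card ≤ (P.filter fun x => R x y).card :=
        Finset.card_le_card fun x hx => by
          simp only [Finset.mem_bipartiteBelow, Finset.mem_inter, Finset.mem_filter] at hx ⊢
          exact ⟨hx.1.2, hx.2⟩
      have h4 : (((UX ∩ P).bipartiteBelow R y).card : ℝ) ≤ (P.filter fun x => R x y).card := by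
        exact_mod_cast h3
      linarith
    have h5 : ((UX ∩ P).card : ℝ) * D ≤ UY.card * ((p + ε) * D') := by
      have h6 := Finset.sum_le_sum h2
      rw [Finset.sum_const, nsmul_eq_mul] at h6
      refine le_trans (le_of_eq ?_) h6
      exact_mod_cast h
    by_cases hpe' : 0 ≤ p + ε
    · have h6 : (UY.card : ℝ) * ((p + ε) * D') ≤ M * Y.card * ((p + ε) * D') :=
        mul_le_mul_of_nonneg_right hM (by positivity)
      have : M * Y.card * ((p + ε) * D') = (p + ε) * X.card * M * D := by
        linear_combination -M * (p + ε) * total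
      exact le_of_mul_le_mul_right (by linarith) hD0
    · have hX0 : (X.card : ℝ) = 0 := by nlinarith
      rw [hX0, mul_zero] at hp
      have : ((UX ∩ P).card : ℝ) ≤ P.card := by
        exact_mod_cast Finset.card_le_card Finset.inter_subset_right
      rw [hX0]
      simpa [hp] using this
  have split : ((UX ∩ P).card : ℝ) + ((P \ UX).card : ℝ) = P.card := by
    have h := Finset.card_inter_add_card_sdiff P UX
    rw [Finset.inter_comm] at h
    exact_mod_cast h
  -- Counting instead the edges at `Y \ UY`, whose endpoints in `P` avoid `UX`, bounds `P \ UX` from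
  -- below and gives an error proportional to `1 - M`. If `p ≤ ε`, the bound by `|P|` already
  -- suffices.
  have down : ((UX ∩ P).card : ℝ) ≤ P.card * M + ε * X.card * (1 - M) := by
    rcases le_total p ε with hpε | hpε
    · have h1 : ((UX ∩ P).card : ℝ) ≤ P.card := by
        exact_mod_cast Finset.card_le_card Finset.inter_subset_right
      have h2 : p * X.card * (1 - M) ≤ ε * X.card * (1 - M) := by
        have : 0 ≤ 1 - M := by linarith
        gcongr
      rw [hp] at h1 ⊢
      linarith
    · have h := Finset.sum_card_bipartiteAbove_eq_sum_card_bipartiteBelow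
        (s := P \ UX) (t := Y) R
      have h1 : ∀ x ∈ P \ UX, (Y.bipartiteAbove R x).card = D := fun x hx =>
        hX x (hPX (Finset.mem_sdiff.1 hx).1)
      rw [Finset.sum_congr rfl h1, Finset.sum_const, smul_eq_mul] at h
      have h2 : ∀ y ∈ Y \ UY, (p - ε) * D' ≤ (((P \ UX).bipartiteBelow R y).card : ℝ) := by
        intro y hy
        rw [Finset.mem_sdiff] at hy
        have := (abs_le.1 (hconc y hy.1)).1
        have h3 : (P.filter fun x => R x y).card ≤ ((P \ UX).bipartiteBelow R y).card :=
          Finset.card_le_card fun x hx => by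
            simp only [Finset.mem_bipartiteBelow, Finset.mem_sdiff, Finset.mem_filter] at hx ⊢
            exact ⟨⟨hx.1, fun hxU => hy.2 (hU x (hPX hx.1) y hy.1 hx.2 hxU)⟩, hx.2⟩
        have h4 : ((P.filter fun x => R x y).card : ℝ) ≤ ((P \ UX).bipartiteBelow R y).card := by
          exact_mod_cast h3
        linarith
      have h5 : ((Y \ UY).card : ℝ) * ((p - ε) * D') ≤ ((P \ UX).card : ℝ) * D := by
        have h6 := Finset.sum_le_sum h2
        rw [Finset.sum_const, nsmul_eq_mul] at h6
        have h7 : ((P \ UX).card : ℝ) * D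
            = ∑ y ∈ Y, (((P \ UX).bipartiteBelow R y).card : ℝ) := by exact_mod_cast h
        rw [h7]
        exact h6.trans (Finset.sum_le_sum_of_subset_of_nonneg Finset.sdiff_subset
          fun _ _ _ => Nat.cast_nonneg _)
      have h6 : (1 - M) * Y.card ≤ ((Y \ UY).card : ℝ) := by
        rw [Finset.cast_card_sdiff hUY]
        linarith
      have h7 : (1 - M) * Y.card * ((p - ε) * D') ≤ ((Y \ UY).card : ℝ) * ((p - ε) * D') :=
        mul_le_mul_of_nonneg_right h6 (mul_nonneg (by linarith) (Nat.cast_nonneg _))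
      have h8 : (1 - M) * Y.card * ((p - ε) * D') = (p - ε) * X.card * (1 - M) * D := by
        linear_combination -(1 - M) * (p - ε) * total
      have h9 : (p - ε) * X.card * (1 - M) ≤ ((P \ UX).card : ℝ) :=
        le_of_mul_le_mul_right (by linarith) hD0
      rw [hp] at split ⊢
      linarith
  rcases min_choice M (1 - M) with h | h <;> rw [h]
  · rw [hp]; linarith
  · exact down

/-! ### Hamming layers and the density of an up-set -/

/-- The Hamming layer of weight `l`. -/
def layer (n l : ℕ) : Finset (Cube n) := Finset.univ.filter fun x => weight x = l

theorem mem_layer {n l : ℕ} {x : Cube n} : x ∈ layer n l ↔ weight x = l := by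
  simp [layer]

/-- The cube as the set of subsets of its coordinates. -/
def supportEquiv (n : ℕ) : Cube n ≃ Finset (Fin n) where
  toFun x := Finset.univ.filter fun i => x i = true
  invFun s i := decide (i ∈ s)
  left_inv x := by ext i; simp
  right_inv s := by ext i; simp

theorem card_supportEquiv {n : ℕ} (x : Cube n) : (supportEquiv n x).card = weight x := rfl

theorem supportEquiv_subset {n : ℕ} {x y : Cube n} :
    supportEquiv n x ⊆ supportEquiv n y ↔ x ≤ y := by
  simp only [supportEquiv, Equiv.coe_fn_mk, Finset.subset_iff, Finset.mem_filter,
    Finset.mem_univ, true_and, Pi.le_def, Bool.le_iff_imp]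

theorem weight_le {n : ℕ} (x : Cube n) : weight x ≤ n := by
  simpa [card_supportEquiv] using Finset.card_le_univ (supportEquiv n x)

theorem weight_mono {n : ℕ} {x y : Cube n} (h : x ≤ y) : weight x ≤ weight y :=
  Finset.card_le_card (supportEquiv_subset.2 h)

theorem weight_strictMono {n : ℕ} {x y : Cube n} (h : x < y) : weight x < weight y := by
  apply Finset.card_lt_card
  rw [Finset.ssubset_iff_subset_ne]
  exact ⟨supportEquiv_subset.2 h.le, fun e => h.ne ((supportEquiv n).injective e)⟩

theorem card_layer (n l : ℕ) : (layer n l).card = n.choose l := by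
  rw [← Finset.card_map (supportEquiv n).toEmbedding]
  trans (Finset.powersetCard l (Finset.univ : Finset (Fin n))).card
  · congr 1
    ext s
    simp only [Finset.mem_map_equiv, mem_layer, Finset.mem_powersetCard, Finset.subset_univ,
      true_and, ← card_supportEquiv, Equiv.apply_symm_apply]
  · simp

open scoped Classical in
theorem card_layer_filter_ge {n l h : ℕ} {x : Cube n} (hx : weight x = l) :
    ((layer n (l + h)).filter fun y => x ≤ y).card = (n - l).choose h := by
  have hc : ((supportEquiv n x)ᶜ).card = n - l := by
    rw [Finset.card_compl, card_supportEquiv, hx, Fintype.card_fin]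
  rw [← hc, ← Finset.card_powersetCard]
  refine Finset.card_bij' (fun y _ => supportEquiv n y \ supportEquiv n x)
    (fun s _ => (supportEquiv n).symm (s ∪ supportEquiv n x)) ?_ ?_ ?_ ?_
  · intro y hy
    rw [Finset.mem_filter, mem_layer] at hy
    rw [Finset.mem_powersetCard]
    refine ⟨fun i hi => by simp only [Finset.mem_sdiff] at hi; simpa using hi.2, ?_⟩
    rw [Finset.card_sdiff_of_subset (supportEquiv_subset.2 hy.2), card_supportEquiv,
      card_supportEquiv, hy.1, hx]
    omega
  · intro s hs
    rw [Finset.mem_powersetCard] at hs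
    rw [Finset.mem_filter, mem_layer]
    constructor
    · rw [← card_supportEquiv, Equiv.apply_symm_apply, Finset.card_union_of_disjoint, hs.2,
        card_supportEquiv, hx, add_comm]
      exact Finset.disjoint_left.2 fun i hi => by simpa using hs.1 hi
    · rw [← supportEquiv_subset, Equiv.apply_symm_apply]
      exact Finset.subset_union_right
  · intro y hy
    rw [Finset.mem_filter] at hy
    rw [Equiv.symm_apply_eq]
    exact Finset.sdiff_union_of_subset (supportEquiv_subset.2 hy.2)
  · intro s hs
    rw [Finset.mem_powersetCard] at hs
    simp only [Equiv.apply_symm_apply]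
    rw [Finset.union_sdiff_right]
    exact Finset.sdiff_eq_self_of_disjoint
      (Finset.disjoint_left.2 fun i hi => by simpa using hs.1 hi)

open scoped Classical in
theorem card_layer_filter_le {n l k : ℕ} {y : Cube n} (hy : weight y = k) :
    ((layer n l).filter fun x => x ≤ y).card = k.choose l := by
  rw [← hy, ← card_supportEquiv, ← Finset.card_powersetCard]
  refine Finset.card_bij' (fun x _ => supportEquiv n x)
    (fun s _ => (supportEquiv n).symm s) ?_ ?_ ?_ ?_
  · intro x hx
    rw [Finset.mem_filter, mem_layer] at hx
    rw [Finset.mem_powersetCard]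
    exact ⟨supportEquiv_subset.2 hx.2, hx.1⟩
  · intro s hs
    rw [Finset.mem_powersetCard] at hs
    rw [Finset.mem_filter, mem_layer, ← card_supportEquiv, ← supportEquiv_subset]
    simpa using hs.symm
  · simp
  · simp

/-- The fraction of the layer of weight `l` that lies in `U`. -/
noncomputable def density {n : ℕ} (U : Finset (Cube n)) (l : ℕ) : ℝ :=
  ((U ∩ layer n l).card : ℝ) / n.choose l

theorem density_mul {n l : ℕ} (U : Finset (Cube n)) (hl : l ≤ n) :
    density U l * (n.choose l : ℝ) = ((U ∩ layer n l).card : ℝ) := by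
  have : (n.choose l : ℝ) ≠ 0 := by exact_mod_cast (Nat.choose_pos hl).ne'
  rw [density, div_mul_cancel₀ _ this]

theorem density_nonneg {n l : ℕ} (U : Finset (Cube n)) : 0 ≤ density U l := by
  unfold density; positivity

theorem density_le_one {n l : ℕ} (U : Finset (Cube n)) : density U l ≤ 1 := by
  unfold density
  apply div_le_one_of_le₀ _ (by positivity)
  rw [← card_layer]
  exact_mod_cast Finset.card_le_card Finset.inter_subset_right

open scoped Classical in
theorem density_compl {n l : ℕ} (U : Finset (Cube n)) (hl : l ≤ n) :
    density Uᶜ l = 1 - density U l := by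
  have h0 : (0 : ℝ) < n.choose l := by exact_mod_cast Nat.choose_pos hl
  apply mul_right_cancel₀ h0.ne'
  rw [sub_mul, density_mul _ hl, density_mul _ hl, one_mul, ← card_layer]
  have := Finset.card_inter_add_card_sdiff (layer n l) U
  rw [eq_sub_iff_add_eq, add_comm]
  rw [Finset.inter_comm U, show Uᶜ ∩ layer n l = layer n l \ U by
    ext; simp [and_comm]]
  exact_mod_cast this

open scoped Classical in
-- The normalized matching property: double counting between two layers, with the whole lower layer
-- as `P`, so that `p = 1` and `ε = 0`.
theorem density_mono {n l k : ℕ} {U : Finset (Cube n)} (hU : IsUpperSet (U : Set (Cube n)))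
    (hlk : l ≤ k) (hk : k ≤ n) : density U l ≤ density U k := by
  obtain ⟨h, rfl⟩ := Nat.exists_eq_add_of_le hlk
  have key := card_inter_le_of_biregular (layer n l) (layer n l) U (layer n (l + h))
    (U ∩ layer n (l + h)) (fun x y => x ≤ y) (D := (n - l).choose h) (D' := (l + h).choose l)
    (p := 1) (ε := 0) (M := density U (l + h)) (Nat.choose_pos (by omega))
    (fun x hx => card_layer_filter_ge (mem_layer.1 hx))
    (fun y hy => card_layer_filter_le (mem_layer.1 hy)) subset_rfl (by simp)
    (fun y hy => by rw [card_layer_filter_le (mem_layer.1 hy)]; simp) le_rfl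
    Finset.inter_subset_right
    (fun x _ y hy hxy hxU => Finset.mem_inter.2 ⟨hU hxy hxU, hy⟩)
    (by rw [card_layer, density_mul _ hk]) (density_le_one U)
  have h0 : (0 : ℝ) < n.choose l := by exact_mod_cast Nat.choose_pos (hlk.trans hk)
  rw [card_layer] at key
  apply le_of_mul_le_mul_right _ h0
  rw [density_mul _ (hlk.trans hk), mul_comm]
  simpa using key

/-! ### Edge expansion of up-sets, by permuting coordinates -/

theorem weight_comp_perm {n : ℕ} (x : Cube n) (σ : Equiv.Perm (Fin n)) :
    weight (x ∘ σ) = weight x := by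
  unfold weight
  exact Finset.card_bijective σ σ.bijective (by simp)

theorem exists_perm_comp_eq {n : ℕ} {x y : Cube n} (h : weight x = weight y) :
    ∃ σ : Equiv.Perm (Fin n), x ∘ σ = y := by
  have h1 : Fintype.card {i // y i = true} = Fintype.card {i // x i = true} := by
    rw [Fintype.card_subtype, Fintype.card_subtype]; exact h.symm
  set e := Fintype.equivOfCardEq h1
  refine ⟨e.extendSubtype, ?_⟩
  funext i
  by_cases hi : y i = true
  · rw [hi]
    exact e.extendSubtype_mem i hi
  · have := e.extendSubtype_not_mem i hi
    simp only [Bool.not_eq_true] at hi this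
    rw [hi]
    exact this

/-- The number of points of `A` that a permutation of the coordinates moves out of `A`. -/
def loss {n : ℕ} (A : Finset (Cube n)) (σ : Equiv.Perm (Fin n)) : ℕ :=
  (A.filter fun x => x ∘ σ ∉ A).card

theorem loss_one {n : ℕ} (A : Finset (Cube n)) : loss A 1 = 0 := by
  rw [loss, Finset.card_eq_zero, Finset.filter_eq_empty_iff]
  exact fun x hx h => h hx

theorem comp_perm_injective {n : ℕ} (σ : Equiv.Perm (Fin n)) :
    Function.Injective fun x : Cube n => x ∘ σ :=
  σ.surjective.injective_comp_right

/-- A point that `σ * τ` moves out of `A` either leaves under `σ`, or its image under `σ` lies in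
`A` and leaves under `τ`. -/
theorem loss_mul_le {n : ℕ} (A : Finset (Cube n)) (σ τ : Equiv.Perm (Fin n)) :
    loss A (σ * τ) ≤ loss A σ + loss A τ := by
  unfold loss
  have h : (A.filter fun x => x ∘ (σ * τ : Equiv.Perm (Fin n)) ∉ A) ⊆
      (A.filter fun x => x ∘ σ ∉ A) ∪
        (A.filter fun x => x ∘ σ ∈ A.filter fun x => x ∘ τ ∉ A) := by
    intro x hx
    rw [Finset.mem_filter] at hx
    rw [Finset.mem_union, Finset.mem_filter, Finset.mem_filter, Finset.mem_filter]
    by_cases h : x ∘ σ ∈ A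
    · exact Or.inr ⟨hx.1, h, hx.2⟩
    · exact Or.inl ⟨hx.1, h⟩
  refine (Finset.card_le_card h).trans ((Finset.card_union_le _ _).trans ?_)
  refine Nat.add_le_add_left ?_ _
  refine Finset.card_le_card_of_injOn (fun x => x ∘ σ) ?_ (comp_perm_injective σ).injOn
  intro x hx
  exact (Finset.mem_filter.1 hx).2

/-- A permutation is a product of at most `n` transpositions, and `loss` is subadditive. The
induction is on the size of the support, which multiplication by `swap i (σ i)` decreases. -/
theorem loss_le_of_swap {n : ℕ} (A : Finset (Cube n)) {K : ℕ}
    (hK : ∀ i j, loss A (Equiv.swap i j) ≤ K) (σ : Equiv.Perm (Fin n)) :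
    loss A σ ≤ n * K := by
  have key : ∀ s : ℕ, ∀ σ : Equiv.Perm (Fin n), σ.support.card ≤ s → loss A σ ≤ s * K := by
    intro s
    induction s with
    | zero =>
      intro σ hσ
      have : σ = 1 := by simpa using hσ
      subst this
      simp [loss_one]
    | succ s ih =>
      intro σ hσ
      by_cases h1 : σ = 1
      · subst h1
        simp [loss_one]
      · obtain ⟨i, hi⟩ : ∃ i, σ i ≠ i := by
          by_contra! h
          exact h1 (Equiv.ext h)
        have h2 := ih (Equiv.swap i (σ i) * σ) (by
          have := Equiv.Perm.card_support_swap_mul hi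
          omega)
        have h3 : σ = Equiv.swap i (σ i) * (Equiv.swap i (σ i) * σ) := by
          rw [← mul_assoc, Equiv.swap_mul_self, one_mul]
        have h4 := loss_mul_le A (Equiv.swap i (σ i)) (Equiv.swap i (σ i) * σ)
        rw [← h3] at h4
        have := hK i (σ i)
        rw [add_mul]
        omega
  exact key n σ (by simpa using Finset.card_le_univ σ.support)

open scoped Classical in
-- A random permutation sends `x` to a uniform point of its layer: right multiplication by `τ`
-- identifies the fibres of `σ ↦ x ∘ σ` over any two points.
theorem card_perm_comp_mul_card_layer {n l : ℕ} {x y : Cube n} (hx : weight x = l)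
    (hy : weight y = l) :
    (Finset.univ.filter fun σ : Equiv.Perm (Fin n) => x ∘ σ = y).card * n.choose l =
      n.factorial := by
  have h1 : ∀ z ∈ layer n l, (Finset.univ.filter fun σ : Equiv.Perm (Fin n) => x ∘ σ = z).card =
      (Finset.univ.filter fun σ : Equiv.Perm (Fin n) => x ∘ σ = y).card := by
    intro z hz
    obtain ⟨τ, hτ⟩ := exists_perm_comp_eq ((mem_layer.1 hz).trans hy.symm)
    refine Finset.card_bijective (fun σ => σ * τ) (Group.mulRight_bijective τ) ?_
    intro σ
    simp only [Finset.mem_filter, Finset.mem_univ, true_and, Equiv.Perm.coe_mul,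
      ← Function.comp_assoc]
    rw [← hτ]
    exact (comp_perm_injective τ).eq_iff.symm
  have h2 := Finset.card_eq_sum_card_fiberwise (s := (Finset.univ : Finset (Equiv.Perm (Fin n))))
    (t := layer n l) (f := fun σ : Equiv.Perm (Fin n) => (x ∘ σ : Cube n))
    (fun σ _ => by simpa [mem_layer] using (weight_comp_perm x σ).trans hx)
  rw [Finset.sum_congr rfl h1, Finset.sum_const, card_layer, smul_eq_mul, Finset.card_univ,
    Fintype.card_perm, Fintype.card_fin] at h2
  rw [h2, mul_comm]

open scoped Classical in
-- The average of `loss A σ` over all `σ` is `|A| * |layer \ A|` divided by the layer size, since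
-- images are uniform in the layer; each term is at most `n * K`.
theorem card_mul_card_sdiff_le {n l : ℕ} {A : Finset (Cube n)} (hA : A ⊆ layer n l) {K : ℕ}
    (hK : ∀ i j, loss A (Equiv.swap i j) ≤ K) :
    A.card * (layer n l \ A).card ≤ n * K * n.choose l := by
  rcases A.eq_empty_or_nonempty with rfl | ⟨x₀, hx₀⟩
  · simp
  have hl : l ≤ n := (mem_layer.1 (hA hx₀)) ▸ weight_le x₀
  have h1 : ∑ σ : Equiv.Perm (Fin n), loss A σ ≤ n.factorial * (n * K) := by
    refine (Finset.sum_le_card_nsmul _ _ _ fun σ _ => loss_le_of_swap A hK σ).trans ?_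
    simp [Fintype.card_perm]
  have h2 : (∑ σ : Equiv.Perm (Fin n), loss A σ) * n.choose l =
      A.card * (layer n l \ A).card * n.factorial := by
    have h3 : ∑ σ : Equiv.Perm (Fin n), loss A σ = ∑ x ∈ A, ∑ y ∈ layer n l \ A,
        (Finset.univ.filter fun σ : Equiv.Perm (Fin n) => x ∘ σ = y).card := by
      simp only [loss, Finset.card_filter]
      rw [Finset.sum_comm]
      refine Finset.sum_congr rfl fun x hx => ?_
      rw [Finset.sum_comm]
      refine Finset.sum_congr rfl fun σ _ => ?_
      rw [Finset.sum_ite_eq]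
      have : x ∘ σ ∈ layer n l := mem_layer.2 ((weight_comp_perm x σ).trans (mem_layer.1 (hA hx)))
      simp [this]
    rw [h3, Finset.sum_mul]
    simp_rw [Finset.sum_mul]
    rw [Finset.sum_congr rfl fun x hx => Finset.sum_congr rfl fun y hy =>
      card_perm_comp_mul_card_layer (mem_layer.1 (hA hx))
        (mem_layer.1 (Finset.mem_sdiff.1 hy).1)]
    simp [mul_assoc]
  have h4 : A.card * (layer n l \ A).card * n.factorial ≤ n * K * n.choose l * n.factorial := by
    rw [← h2]
    calc _ ≤ n.factorial * (n * K) * n.choose l := Nat.mul_le_mul_right _ h1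
      _ = _ := by ring
  exact Nat.le_of_mul_le_mul_right h4 (Nat.factorial_pos n)

theorem weight_sup_swap {n : ℕ} {x : Cube n} {i j : Fin n} (hi : x i = true) (hj : x j = false) :
    weight (x ⊔ x ∘ Equiv.swap i j) = weight x + 1 := by
  rw [← card_supportEquiv, ← card_supportEquiv]
  have : supportEquiv n (x ⊔ x ∘ Equiv.swap i j) = insert j (supportEquiv n x) := by
    ext k
    simp only [supportEquiv, Equiv.coe_fn_mk, Finset.mem_filter, Finset.mem_univ, true_and,
      Finset.mem_insert, Pi.sup_apply, Function.comp]
    rcases eq_or_ne k j with rfl | hkj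
    · simp [hi]
    rcases eq_or_ne k i with rfl | hki
    · simp [hi]
    · simp [Equiv.swap_apply_of_ne_of_ne hki hkj, hkj]
  rw [this, Finset.card_insert_of_notMem]
  simp [supportEquiv, hj]

open scoped Classical in
/-- An up-set grows from each layer to the next. -/
theorem density_succ_ge {n l : ℕ} {U : Finset (Cube n)} (hU : IsUpperSet (U : Set (Cube n)))
    (hl : l + 1 ≤ n) :
    density U l + density U l * (1 - density U l) / n ^ 2 ≤ density U (l + 1) := by
  set A := U ∩ layer n l with hA
  set T := ((layer n l \ U) ×ˢ (U ∩ layer n (l + 1))).filter fun p => p.1 ≤ p.2 with hT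
  -- If a swap moves `x ∈ U` out of `U`, then the join of `x` and its image lies in `U`, one layer
  -- up, above a point outside `U`. So each such `x` yields an edge in `T`, and the lower endpoint
  -- recovers `x`.
  have hK : ∀ i j, loss A (Equiv.swap i j) ≤ T.card := by
    intro i j
    refine Finset.card_le_card_of_injOn
      (fun x => (x ∘ Equiv.swap i j, x ⊔ x ∘ Equiv.swap i j)) ?_ ?_
    · intro x hx
      simp only [Finset.coe_filter, Set.mem_ofPred_eq, hA, Finset.mem_inter, mem_layer,
        weight_comp_perm] at hx
      obtain ⟨⟨hxU, hxl⟩, hx2⟩ := hx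
      have hsw : x ∘ Equiv.swap i j ∉ U := fun h => hx2 ⟨h, hxl⟩
      have hw : weight (x ⊔ x ∘ Equiv.swap i j) = l + 1 := by
        cases hi : x i <;> cases hj : x j
        · exfalso
          apply hsw
          convert hxU
          ext k
          simp only [Function.comp, Equiv.swap_apply_def]
          split_ifs <;> simp_all
        · rw [Equiv.swap_comm, weight_sup_swap hj hi, hxl]
        · rw [weight_sup_swap hi hj, hxl]
        · exfalso
          apply hsw
          convert hxU
          ext k
          simp only [Function.comp, Equiv.swap_apply_def]
          split_ifs <;> simp_all
      simp only [hT, Finset.coe_filter, Set.mem_ofPred_eq, Finset.mem_product, Finset.mem_sdiff,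
        mem_layer, weight_comp_perm, Finset.mem_inter]
      exact ⟨⟨⟨hxl, hsw⟩, hU le_sup_left hxU, hw⟩, le_sup_right⟩
    · intro x _ y _ hxy
      exact comp_perm_injective _ (Prod.ext_iff.1 hxy).1
  have h1 := card_mul_card_sdiff_le (l := l) (Finset.inter_subset_right) hK
  -- Each point of `U` in layer `l + 1` has `l + 1` lower neighbours and each point of `U` in layer
  -- `l` has `n - l` upper neighbours, all in `U`. The difference of the two counts is the number of
  -- edges entering `U` from outside.
  have hcount : (T.card : ℝ) = (density U (l + 1) - density U l) * (n.choose l * (n - l : ℕ)) := by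
    have e1 := Finset.sum_card_bipartiteAbove_eq_sum_card_bipartiteBelow
      (s := layer n l) (t := U ∩ layer n (l + 1)) (fun x y => x ≤ y)
    have e2 : ∀ y ∈ U ∩ layer n (l + 1),
        ((layer n l).bipartiteBelow (fun x y => x ≤ y) y).card = l + 1 := by
      intro y hy
      have := card_layer_filter_le (l := l) (mem_layer.1 (Finset.mem_inter.1 hy).2)
      rw [Nat.choose_succ_self_right] at this
      exact this
    rw [Finset.sum_congr rfl e2, ← Finset.sum_sdiff (Finset.inter_subset_right (s₁ := U)),
      Finset.sum_const, smul_eq_mul] at e1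
    have e3 : ∀ x ∈ U ∩ layer n l,
        ((U ∩ layer n (l + 1)).bipartiteAbove (fun x y => x ≤ y) x).card = n - l := by
      intro x hx
      rw [Finset.mem_inter, mem_layer] at hx
      have := card_layer_filter_ge (h := 1) hx.2
      rw [Nat.choose_one_right] at this
      rw [← this]
      congr 1
      ext y
      simp only [Finset.mem_bipartiteAbove, Finset.mem_filter, Finset.mem_inter]
      exact ⟨fun h => ⟨h.1.2, h.2⟩, fun h => ⟨⟨hU h.2 hx.1, h.1⟩, h.2⟩⟩
    rw [Finset.sum_congr rfl e3, Finset.sum_const, smul_eq_mul, Finset.sdiff_inter_self_right] at e1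
    have e4 : T.card = ∑ x ∈ layer n l \ U,
        ((U ∩ layer n (l + 1)).bipartiteAbove (fun x y => x ≤ y) x).card := by
      rw [hT, Finset.card_filter, Finset.sum_product]
      simp only [Finset.bipartiteAbove, Finset.card_filter]
    rw [← e4] at e1
    have e5 : ((U ∩ layer n (l + 1)).card : ℝ) = density U (l + 1) * n.choose (l + 1) :=
      (density_mul U hl).symm
    have e6 : ((U ∩ layer n l).card : ℝ) = density U l * n.choose l :=
      (density_mul U (by omega)).symm
    have e7 : (n.choose (l + 1) : ℝ) * (l + 1) = n.choose l * (n - l : ℕ) := by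
      exact_mod_cast Nat.choose_succ_right_eq n l
    have e8 : (T.card : ℝ) + (U ∩ layer n l).card * (n - l : ℕ) =
        (U ∩ layer n (l + 1)).card * (l + 1) := by exact_mod_cast e1
    rw [e5, e6] at e8
    linear_combination e8 + density U (l + 1) * e7
  have hn0 : (0 : ℝ) < n := by exact_mod_cast (by omega : 0 < n)
  have hc0 : (0 : ℝ) < n.choose l := by exact_mod_cast Nat.choose_pos (by omega)
  have h2 : (density U l * n.choose l) * ((1 - density U l) * n.choose l) ≤
      n * ((density U (l + 1) - density U l) * (n.choose l * (n - l : ℕ))) * n.choose l := by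
    rw [density_mul U (by omega), ← density_compl U (by omega), density_mul _ (by omega), ← hcount]
    have : Uᶜ ∩ layer n l = layer n l \ (U ∩ layer n l) := by
      ext; simp only [Finset.mem_inter, Finset.mem_compl, Finset.mem_sdiff]; tauto
    rw [this]
    exact_mod_cast h1
  have h3 : density U l * (1 - density U l) ≤
      n * (density U (l + 1) - density U l) * (n - l : ℕ) := by
    refine le_of_mul_le_mul_right ?_ (mul_pos hc0 hc0)
    linarith
  have h4 : 0 ≤ density U (l + 1) - density U l :=
    sub_nonneg.2 (density_mono hU (Nat.le_succ l) hl)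
  have h5 : ((n - l : ℕ) : ℝ) ≤ n := by exact_mod_cast Nat.sub_le n l
  have h6 : density U l * (1 - density U l) / n ^ 2 ≤ density U (l + 1) - density U l := by
    rw [div_le_iff₀ (by positivity)]
    refine h3.trans ?_
    have := mul_le_mul_of_nonneg_left h5 (mul_nonneg hn0.le h4)
    linarith
  linarith

/-! ### Layer orderings and their initial segments -/

open scoped Classical in
/-- The layer orderings as a finset. -/
noncomputable def layerOrderingsFinset (n : ℕ) : Finset (Cube n ≃ Fin (2 ^ n)) :=
  Finset.univ.filter fun π => π ∈ layerOrderings n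

theorem mem_layerOrderingsFinset {n : ℕ} {π : Cube n ≃ Fin (2 ^ n)} :
    π ∈ layerOrderingsFinset n ↔ π ∈ layerOrderings n := by
  simp [layerOrderingsFinset]

theorem ncard_layerOrderings (n : ℕ) :
    (layerOrderings n).ncard = (layerOrderingsFinset n).card := by
  rw [← Set.ncard_coe_finset]
  congr 1
  ext π
  simp [mem_layerOrderingsFinset]

theorem layerOrderings_nonempty (n : ℕ) : (layerOrderings n).Nonempty := by
  have e : Cube n ≃ Fin (2 ^ n) := Fintype.equivFinOfCardEq (by simp)
  let σ := Tuple.sort (weight ∘ e.symm)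
  refine ⟨e.trans σ.symm, fun x y hxy => ?_⟩
  by_contra! h
  have := Tuple.monotone_sort (weight ∘ e.symm) h
  simp only [Function.comp, Equiv.trans_apply] at this
  rw [Equiv.apply_symm_apply, Equiv.apply_symm_apply, Equiv.symm_apply_apply,
    Equiv.symm_apply_apply] at this
  omega

/-- The points among the first `t` in the ordering `π`. -/
def before {n : ℕ} (π : Cube n ≃ Fin (2 ^ n)) (t : ℕ) : Finset (Cube n) :=
  Finset.univ.filter fun x => (π x : ℕ) < t

theorem mem_before {n : ℕ} {π : Cube n ≃ Fin (2 ^ n)} {t : ℕ} {x : Cube n} :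
    x ∈ before π t ↔ (π x : ℕ) < t := by simp [before]

theorem before_mono {n : ℕ} (π : Cube n ≃ Fin (2 ^ n)) {s t : ℕ} (h : s ≤ t) :
    before π s ⊆ before π t := fun x hx => by
  rw [mem_before] at hx ⊢; omega

theorem card_before {n : ℕ} (π : Cube n ≃ Fin (2 ^ n)) {t : ℕ} (ht : t ≤ 2 ^ n) :
    (before π t).card = t := by
  rw [← Finset.card_range t]
  refine Finset.card_bij (fun x _ => (π x : ℕ)) ?_ ?_ ?_
  · intro x hx
    simpa [mem_before] using hx
  · intro x _ y _ h
    exact π.injective (Fin.ext h)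
  · intro s hs
    rw [Finset.mem_range] at hs
    exact ⟨π.symm ⟨s, by omega⟩, by simp [mem_before, hs], by simp⟩

/-- The points of weight less than `l`. -/
def below (n l : ℕ) : Finset (Cube n) := Finset.univ.filter fun x => weight x < l

theorem mem_below {n l : ℕ} {x : Cube n} : x ∈ below n l ↔ weight x < l := by simp [below]

/-- Initial segments and unions of lowest layers form a chain, so cardinalities decide inclusion and
the number of points of each weight in an initial segment does not depend on the ordering. -/
theorem below_subset_or {n : ℕ} {π : Cube n ≃ Fin (2 ^ n)} (hπ : π ∈ layerOrderings n)
    (l t : ℕ) : below n l ⊆ before π t ∨ before π t ⊆ below n l := by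
  by_contra! h
  obtain ⟨h1, h2⟩ := h
  obtain ⟨x, hx, hxt⟩ := Finset.not_subset.1 h1
  obtain ⟨y, hy, hyl⟩ := Finset.not_subset.1 h2
  rw [mem_below] at hx hyl
  rw [mem_before] at hxt hy
  have := hπ x y (by omega)
  rw [Fin.lt_def] at this
  omega

theorem below_subset_before {n : ℕ} {π : Cube n ≃ Fin (2 ^ n)} (hπ : π ∈ layerOrderings n)
    {l t : ℕ} (ht : t ≤ 2 ^ n) (h : (below n l).card ≤ t) : below n l ⊆ before π t := by
  rcases below_subset_or hπ l t with h1 | h1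
  · exact h1
  · exact (Finset.eq_of_subset_of_card_le h1 (by rwa [card_before π ht])).ge

theorem before_subset_below {n : ℕ} {π : Cube n ≃ Fin (2 ^ n)} (hπ : π ∈ layerOrderings n)
    {l t : ℕ} (ht : t ≤ 2 ^ n) (h : t ≤ (below n l).card) : before π t ⊆ below n l := by
  rcases below_subset_or hπ l t with h1 | h1
  · exact (Finset.eq_of_subset_of_card_le h1 (by rwa [card_before π ht])).ge
  · exact h1

theorem card_before_inter_below {n : ℕ} {π : Cube n ≃ Fin (2 ^ n)} (hπ : π ∈ layerOrderings n)
    (l : ℕ) {t : ℕ} (ht : t ≤ 2 ^ n) :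
    (before π t ∩ below n l).card = min t (below n l).card := by
  rcases le_total t (below n l).card with h | h
  · rw [Finset.inter_eq_left.2 (before_subset_below hπ ht h), card_before π ht, min_eq_left h]
  · rw [Finset.inter_eq_right.2 (below_subset_before hπ ht h), min_eq_right h]

/-- The number of points of weight `l` among the first `t` in any layer ordering. -/
def cutCount (n l t : ℕ) : ℕ := min t (below n (l + 1)).card - min t (below n l).card

theorem card_before_inter_layer {n : ℕ} {π : Cube n ≃ Fin (2 ^ n)} (hπ : π ∈ layerOrderings n)
    (l : ℕ) {t : ℕ} (ht : t ≤ 2 ^ n) : (before π t ∩ layer n l).card = cutCount n l t := by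
  rw [cutCount, ← card_before_inter_below hπ l ht, ← card_before_inter_below hπ (l + 1) ht,
    ← Finset.card_sdiff_of_subset]
  · congr 1
    ext x
    simp only [Finset.mem_inter, Finset.mem_sdiff, mem_layer, mem_below]
    constructor
    · rintro ⟨h1, h2⟩; exact ⟨⟨h1, by omega⟩, fun h => by omega⟩
    · rintro ⟨⟨h1, h2⟩, h3⟩
      refine ⟨h1, ?_⟩
      by_contra h
      exact h3 ⟨h1, by omega⟩
  · intro x
    simp only [Finset.mem_inter, mem_below]
    rintro ⟨h1, h2⟩; exact ⟨h1, by omega⟩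

/-! ### Concentration for a random layer ordering -/

open scoped Classical in
/-- The points of the layer of weight `l` at the positions in `I`. -/
noncomputable def slot {n : ℕ} (l : ℕ) (I : Set ℕ) (π : Cube n ≃ Fin (2 ^ n)) : Finset (Cube n) :=
  (layer n l).filter fun x => (π x : ℕ) ∈ I

theorem mem_slot {n l : ℕ} {I : Set ℕ} {π : Cube n ≃ Fin (2 ^ n)} {x : Cube n} :
    x ∈ slot l I π ↔ x ∈ layer n l ∧ (π x : ℕ) ∈ I := by simp [slot]

theorem swap_trans_mem {n l : ℕ} {x y : Cube n} (hx : x ∈ layer n l) (hy : y ∈ layer n l)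
    {π : Cube n ≃ Fin (2 ^ n)} (hπ : π ∈ layerOrderings n) :
    (Equiv.swap x y).trans π ∈ layerOrderings n := by
  have hw : ∀ z, weight (Equiv.swap x y z) = weight z := by
    rw [mem_layer] at hx hy
    intro z
    rcases eq_or_ne z x with rfl | h1
    · rw [Equiv.swap_apply_left, hx, hy]
    rcases eq_or_ne z y with rfl | h2
    · rw [Equiv.swap_apply_right, hx, hy]
    · rw [Equiv.swap_apply_of_ne_of_ne h1 h2]
  intro z w h
  exact hπ _ _ (by rwa [hw, hw])

open scoped Classical in
-- Sampling without replacement is negatively correlated: `J` falls into the slot with probability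
-- at most `(s / n.choose l) ^ |J|`. Exchanging two points of a layer preserves the uniform measure,
-- so all points outside `J` are equally likely to extend `J` inside the slot.
theorem card_subset_slot_mul_le {n l : ℕ} {I : Set ℕ} {s : ℕ}
    (hs : ∀ π ∈ layerOrderingsFinset n, (slot l I π).card = s) (J : Finset (Cube n))
    (hJ : J ⊆ layer n l) :
    ((layerOrderingsFinset n).filter fun π => J ⊆ slot l I π).card * n.choose l ^ J.card ≤
      (layerOrderingsFinset n).card * s ^ J.card := by
  induction J using Finset.induction_on with
  | empty => simp
  | insert x J hxJ ih =>
    have hx : x ∈ layer n l := hJ (Finset.mem_insert_self x J)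
    have hJ' : J ⊆ layer n l := (Finset.subset_insert x J).trans hJ
    set c := ((layerOrderingsFinset n).filter fun π => J ⊆ slot l I π).card with hc
    set c' := ((layerOrderingsFinset n).filter fun π => insert x J ⊆ slot l I π).card with hc'
    have hcc : c' ≤ c := Finset.card_le_card fun π hπ => by
      rw [Finset.mem_filter] at hπ ⊢
      exact ⟨hπ.1, (Finset.subset_insert x J).trans hπ.2⟩
    have h1 : ∀ y ∈ layer n l \ J,
        ((layerOrderingsFinset n).filter fun π => insert y J ⊆ slot l I π).card = c' := by
      intro y hy
      rw [Finset.mem_sdiff] at hy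
      have hmem : ∀ π : Cube n ≃ Fin (2 ^ n), ∀ z ∈ J,
          z ∈ slot l I ((Equiv.swap x y).trans π) ↔ z ∈ slot l I π := by
        intro π z hz
        rw [mem_slot, mem_slot, Equiv.trans_apply, Equiv.swap_apply_of_ne_of_ne]
        · rintro rfl; exact hxJ hz
        · rintro rfl; exact hy.2 hz
      refine Finset.card_bij' (fun π _ => (Equiv.swap x y).trans π)
        (fun π _ => (Equiv.swap x y).trans π) ?_ ?_ ?_ ?_
      · intro π hπ
        rw [Finset.mem_filter, mem_layerOrderingsFinset] at hπ ⊢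
        refine ⟨swap_trans_mem hx hy.1 hπ.1, ?_⟩
        rw [Finset.insert_subset_iff] at hπ ⊢
        refine ⟨?_, fun z hz => (hmem π z hz).2 (hπ.2.2 hz)⟩
        rw [mem_slot, Equiv.trans_apply, Equiv.swap_apply_left]
        exact ⟨hx, (mem_slot.1 hπ.2.1).2⟩
      · intro π hπ
        rw [Finset.mem_filter, mem_layerOrderingsFinset] at hπ ⊢
        refine ⟨swap_trans_mem hx hy.1 hπ.1, ?_⟩
        rw [Finset.insert_subset_iff] at hπ ⊢
        refine ⟨?_, fun z hz => (hmem π z hz).2 (hπ.2.2 hz)⟩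
        rw [mem_slot, Equiv.trans_apply, Equiv.swap_apply_right]
        exact ⟨hy.1, (mem_slot.1 hπ.2.1).2⟩
      · intro π _; ext z; simp
      · intro π _; ext z; simp
    -- Count pairs of an ordering with `J` inside the slot and a point of the slot; the points of
    -- `J` always count.
    have h2 : (layer n l \ J).card * c' + J.card * c = s * c := by
      have h3 : (layer n l \ J).card * c' = ∑ π ∈ (layerOrderingsFinset n).filter
          (fun π => J ⊆ slot l I π), (slot l I π \ J).card := by
        rw [← smul_eq_mul, ← Finset.sum_const, ← Finset.sum_congr rfl h1]
        simp only [Finset.card_filter]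
        rw [Finset.sum_comm, Finset.sum_filter]
        refine Finset.sum_congr rfl fun π _ => ?_
        rw [← Finset.card_filter]
        split_ifs with h
        · congr 1
          ext y
          simp only [Finset.mem_filter, Finset.mem_sdiff, Finset.insert_subset_iff, mem_slot]
          tauto
        · rw [Finset.card_eq_zero, Finset.filter_eq_empty_iff]
          exact fun y _ hy => h ((Finset.subset_insert y J).trans hy)
      rw [h3, hc, mul_comm J.card, mul_comm s, ← smul_eq_mul, ← smul_eq_mul,
        ← Finset.sum_const, ← Finset.sum_const, ← Finset.sum_add_distrib]
      refine Finset.sum_congr rfl fun π hπ => ?_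
      rw [Finset.mem_filter] at hπ
      rw [Finset.card_sdiff_of_subset hπ.2, ← hs π hπ.1]
      exact Nat.sub_add_cancel (Finset.card_le_card hπ.2)
    rw [Finset.card_sdiff_of_subset hJ', card_layer] at h2
    have hJn : J.card ≤ n.choose l := card_layer n l ▸ Finset.card_le_card hJ'
    -- Replace `c` by the smaller `c'` in the term `J.card * c` of `h2`.
    have h4 : c' * n.choose l ≤ s * c := by
      obtain ⟨k, hk⟩ := Nat.exists_eq_add_of_le hJn
      rw [hk] at h2 ⊢
      rw [Nat.add_sub_cancel_left] at h2
      nlinarith [Nat.mul_le_mul_left J.card hcc]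
    rw [Finset.card_insert_of_notMem hxJ, pow_succ, pow_succ]
    calc c' * (n.choose l ^ J.card * n.choose l) = (c' * n.choose l) * n.choose l ^ J.card := by
          ring
      _ ≤ s * c * n.choose l ^ J.card := Nat.mul_le_mul_right _ h4
      _ = s * (c * n.choose l ^ J.card) := by ring
      _ ≤ s * ((layerOrderingsFinset n).card * s ^ J.card) := Nat.mul_le_mul_left _ (ih hJ')
      _ = _ := by ring

open scoped Classical in
-- Expanding `(1 + z) ^ |N ∩ slot|` over subsets `J` of `N` reduces to the inclusion probabilities.
-- The moment generating function is thus dominated by the binomial one.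
theorem sum_pow_card_inter_slot_le {n l : ℕ} (hl : l ≤ n) {I : Set ℕ} {s : ℕ}
    (hs : ∀ π ∈ layerOrderingsFinset n, (slot l I π).card = s) (N : Finset (Cube n))
    (hN : N ⊆ layer n l) {z : ℝ} (hz : 0 ≤ z) :
    ∑ π ∈ layerOrderingsFinset n, (1 + z) ^ (N ∩ slot l I π).card ≤
      (layerOrderingsFinset n).card * (1 + z * (s / n.choose l)) ^ N.card := by
  have hc0 : (0 : ℝ) < n.choose l := by exact_mod_cast Nat.choose_pos hl
  have h1 : ∀ π : Cube n ≃ Fin (2 ^ n), (1 + z) ^ (N ∩ slot l I π).card =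
      ∑ J ∈ N.powerset, if J ⊆ slot l I π then z ^ J.card else 0 := by
    intro π
    rw [← Finset.prod_const, Finset.prod_one_add, ← Finset.sum_filter]
    simp only [Finset.prod_const]
    refine Finset.sum_congr ?_ fun _ _ => rfl
    ext J
    rw [Finset.mem_powerset, Finset.mem_filter, Finset.mem_powerset, Finset.subset_inter_iff]
  rw [Finset.sum_congr rfl fun π _ => h1 π, Finset.sum_comm, ← Finset.prod_const,
    Finset.prod_one_add, Finset.mul_sum]
  refine Finset.sum_le_sum fun J hJ => ?_
  rw [Finset.mem_powerset] at hJ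
  rw [← Finset.sum_filter, Finset.sum_const, nsmul_eq_mul, Finset.prod_const, mul_pow, div_pow]
  have h2 : ((((layerOrderingsFinset n).filter fun π => J ⊆ slot l I π).card : ℕ) : ℝ) *
      (n.choose l : ℝ) ^ J.card ≤ (layerOrderingsFinset n).card * (s : ℝ) ^ J.card := by
    exact_mod_cast card_subset_slot_mul_le hs J (hJ.trans hN)
  have h3 : ((((layerOrderingsFinset n).filter fun π => J ⊆ slot l I π).card : ℕ) : ℝ) ≤
      (layerOrderingsFinset n).card * (s : ℝ) ^ J.card / (n.choose l : ℝ) ^ J.card := by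
    rw [le_div_iff₀ (by positivity)]; exact h2
  calc _ ≤ (layerOrderingsFinset n).card * (s : ℝ) ^ J.card / (n.choose l : ℝ) ^ J.card *
        z ^ J.card := mul_le_mul_of_nonneg_right h3 (by positivity)
    _ = _ := by ring

open scoped Classical in
/-- A Chernoff bound for sampling without replacement. -/
theorem card_slot_tail_le {n l : ℕ} (hl : l ≤ n) {I : Set ℕ} {s : ℕ}
    (hs : ∀ π ∈ layerOrderingsFinset n, (slot l I π).card = s) (hsn : s ≤ n.choose l)
    (N : Finset (Cube n)) (hN : N ⊆ layer n l) {ε : ℝ} (hε : 0 ≤ ε) (hε1 : ε ≤ 1) :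
    (((layerOrderingsFinset n).filter fun π =>
      (s / n.choose l + ε) * N.card ≤ ((N ∩ slot l I π).card : ℝ)).card : ℝ) ≤
      (layerOrderingsFinset n).card * Real.exp (-(ε ^ 2 * N.card / 4)) := by
  have hc0 : (0 : ℝ) < n.choose l := by exact_mod_cast Nat.choose_pos hl
  set p : ℝ := s / n.choose l with hp
  have hp0 : 0 ≤ p := by positivity
  have hp1 : p ≤ 1 := by
    rw [hp, div_le_one hc0]; exact_mod_cast hsn
  have hexp : 1 ≤ Real.exp (ε / 2) := Real.one_le_exp (by linarith)
  -- Markov's inequality with exponential parameter `ε / 2`: the threshold contributes `-ε ^ 2 / 2`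
  -- per point of `N` and the second-order term at most `ε ^ 2 / 4`.
  have h1 := sum_pow_card_inter_slot_le hl hs N hN (z := Real.exp (ε / 2) - 1) (by linarith)
  rw [add_sub_cancel] at h1
  set B := (layerOrderingsFinset n).filter fun π => (p + ε) * N.card ≤
    ((N ∩ slot l I π).card : ℝ) with hB
  have h2 : (B.card : ℝ) * Real.exp (ε / 2 * ((p + ε) * N.card)) ≤
      ∑ π ∈ layerOrderingsFinset n, Real.exp (ε / 2) ^ (N ∩ slot l I π).card := by
    rw [← nsmul_eq_mul, ← Finset.sum_const]
    refine (Finset.sum_le_sum fun π hπ => ?_).trans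
      (Finset.sum_le_sum_of_subset_of_nonneg (Finset.filter_subset _ _)
        fun _ _ _ => by positivity)
    rw [hB, Finset.mem_filter] at hπ
    rw [← Real.exp_nat_mul, Real.exp_le_exp, mul_comm]
    exact mul_le_mul_of_nonneg_right hπ.2 (by linarith)
  have h3 : 1 + (Real.exp (ε / 2) - 1) * p ≤ Real.exp (ε / 2 * p + ε ^ 2 / 4) := by
    have h4 : Real.exp (ε / 2) - 1 ≤ ε / 2 + (ε / 2) ^ 2 := by
      have := Real.abs_exp_sub_one_sub_id_le (x := ε / 2) (by rw [abs_le]; constructor <;> linarith)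
      linarith [(abs_le.1 this).2]
    have h5 : (Real.exp (ε / 2) - 1) * p ≤ ε / 2 * p + ε ^ 2 / 4 := by
      have h6 := mul_le_mul_of_nonneg_right h4 hp0
      nlinarith [sq_nonneg ε]
    linarith [Real.add_one_le_exp (ε / 2 * p + ε ^ 2 / 4)]
  have h4 : (1 + (Real.exp (ε / 2) - 1) * p) ^ N.card ≤
      Real.exp (N.card * (ε / 2 * p + ε ^ 2 / 4)) := by
    rw [Real.exp_nat_mul]
    exact pow_le_pow_left₀ (by nlinarith) h3 _
  have h5 := (h2.trans h1).trans (mul_le_mul_of_nonneg_left h4 (Nat.cast_nonneg _))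
  rw [← div_le_div_iff_of_pos_right (Real.exp_pos (ε / 2 * ((p + ε) * N.card))),
    mul_div_assoc, div_self (Real.exp_pos _).ne', mul_one, mul_div_assoc, ← Real.exp_sub] at h5
  refine h5.trans (le_of_eq ?_)
  congr 2
  ring

open scoped Classical in
/-- With high probability, the first `t` points of a random layer ordering contain about the
expected proportion of a given subset of a layer. -/
theorem card_before_deviation_le {n l t : ℕ} (hl : l ≤ n) (ht : t ≤ 2 ^ n)
    (N : Finset (Cube n)) (hN : N ⊆ layer n l) {ε : ℝ} (hε : 0 ≤ ε) (hε1 : ε ≤ 1) :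
    (((layerOrderingsFinset n).filter fun π =>
      ε * N.card < |((N ∩ before π t).card : ℝ) - cutCount n l t / n.choose l * N.card|).card : ℝ) ≤
      2 * (layerOrderingsFinset n).card * Real.exp (-(ε ^ 2 * N.card / 4)) := by
  have hc0 : (0 : ℝ) < n.choose l := by exact_mod_cast Nat.choose_pos hl
  have e1 : ∀ π : Cube n ≃ Fin (2 ^ n), slot l (Set.Iio t) π = before π t ∩ layer n l := by
    intro π; ext x; simp [mem_slot, mem_before, and_comm]
  -- The lower tail for positions below `t` is the upper tail for positions from `t` on.
  have e2 : ∀ π : Cube n ≃ Fin (2 ^ n), slot l (Set.Ici t) π = layer n l \ before π t := by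
    intro π; ext x; simp [mem_slot, mem_before]
  have s1 : ∀ π ∈ layerOrderingsFinset n, (slot l (Set.Iio t) π).card = cutCount n l t := by
    intro π hπ
    rw [e1, card_before_inter_layer (mem_layerOrderingsFinset.1 hπ) l ht]
  have hsub : ∀ π ∈ layerOrderingsFinset n, cutCount n l t ≤ n.choose l := by
    intro π hπ
    rw [← s1 π hπ, e1, ← card_layer]
    exact Finset.card_le_card Finset.inter_subset_right
  obtain ⟨π₀, hπ₀⟩ := layerOrderings_nonempty n
  have hle := hsub π₀ (mem_layerOrderingsFinset.2 hπ₀)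
  have s2 : ∀ π ∈ layerOrderingsFinset n,
      (slot l (Set.Ici t) π).card = n.choose l - cutCount n l t := by
    intro π hπ
    have := Finset.card_inter_add_card_sdiff (layer n l) (before π t)
    rw [Finset.inter_comm, ← e1, ← e2, s1 π hπ, card_layer] at this
    omega
  have t1 := card_slot_tail_le hl s1 hle N hN hε hε1
  have t2 := card_slot_tail_le hl s2 (Nat.sub_le _ _) N hN hε hε1
  have hsubset : ((layerOrderingsFinset n).filter fun π =>
      ε * N.card < |((N ∩ before π t).card : ℝ) - cutCount n l t / n.choose l * N.card|) ⊆
      ((layerOrderingsFinset n).filter fun π => ((cutCount n l t : ℕ) / n.choose l + ε) * N.card ≤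
        ((N ∩ slot l (Set.Iio t) π).card : ℝ)) ∪
      ((layerOrderingsFinset n).filter fun π =>
        ((n.choose l - cutCount n l t : ℕ) / n.choose l + ε) * N.card ≤
        ((N ∩ slot l (Set.Ici t) π).card : ℝ)) := by
    intro π hπ
    rw [Finset.mem_filter] at hπ
    rw [Finset.mem_union, Finset.mem_filter, Finset.mem_filter]
    have i1 : N ∩ slot l (Set.Iio t) π = N ∩ before π t := by
      rw [e1]; ext x; simp only [Finset.mem_inter]
      exact ⟨fun h => ⟨h.1, h.2.1⟩, fun h => ⟨h.1, h.2, hN h.1⟩⟩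
    have i2 : N ∩ slot l (Set.Ici t) π = N \ before π t := by
      rw [e2]; ext x; simp only [Finset.mem_inter, Finset.mem_sdiff]
      exact ⟨fun h => ⟨h.1, h.2.2⟩, fun h => ⟨h.1, hN h.1, h.2⟩⟩
    rw [i1, i2, Nat.cast_sub hle, sub_div, div_self hc0.ne']
    have i3 : ((N ∩ before π t).card : ℝ) + (N \ before π t).card = N.card := by
      exact_mod_cast Finset.card_inter_add_card_sdiff N (before π t)
    rcases lt_abs.1 hπ.2 with h | h
    · left; exact ⟨hπ.1, by linarith⟩
    · right; exact ⟨hπ.1, by linarith⟩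
  have h3 := Nat.cast_le (α := ℝ).2
    ((Finset.card_le_card hsubset).trans (Finset.card_union_le _ _))
  rw [Nat.cast_add] at h3
  linarith

/-! ### Layer sizes, Chebyshev's inequality and ten-step neighbourhoods -/

theorem centralBinom_sq_mul_le (k : ℕ) : k.centralBinom ^ 2 * (2 * k + 1) ≤ 16 ^ k := by
  induction k with
  | zero => simp
  | succ k ih =>
    have h := Nat.succ_mul_centralBinom_succ k
    refine Nat.le_of_mul_le_mul_left (c := (k + 1) ^ 2) ?_ (by positivity)
    calc (k + 1) ^ 2 * ((k + 1).centralBinom ^ 2 * (2 * (k + 1) + 1))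
        = ((k + 1) * (k + 1).centralBinom) ^ 2 * (2 * (k + 1) + 1) := by ring
      _ = 4 * ((2 * k + 1) * (2 * k + 3)) * (k.centralBinom ^ 2 * (2 * k + 1)) := by
          rw [h]; ring
      _ ≤ 4 * (4 * (k + 1) ^ 2) * 16 ^ k :=
          Nat.mul_le_mul (Nat.mul_le_mul_left 4 (by nlinarith)) ih
      _ = (k + 1) ^ 2 * 16 ^ (k + 1) := by ring

/-- A layer has at most `2 ^ n / √n` points. Odd rows reduce to even ones by Pascal's rule. -/
theorem choose_sq_mul_le (n l : ℕ) : n.choose l ^ 2 * n ≤ 4 ^ n := by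
  rcases Nat.even_or_odd' n with ⟨k, rfl | rfl⟩
  · have h := Nat.choose_le_centralBinom l k
    calc (2 * k).choose l ^ 2 * (2 * k) ≤ k.centralBinom ^ 2 * (2 * k + 1) := by gcongr; omega
      _ ≤ 16 ^ k := centralBinom_sq_mul_le k
      _ = 4 ^ (2 * k) := by rw [pow_mul]; norm_num
  · have h : (2 * k + 1).choose l ≤ 2 * k.centralBinom := by
      cases l with
      | zero => have := Nat.centralBinom_pos k; simp; omega
      | succ l =>
        rw [Nat.choose_succ_succ]
        have h1 := Nat.choose_le_centralBinom l k
        have h2 := Nat.choose_le_centralBinom (l + 1) k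
        simp only [Nat.succ_eq_add_one]
        omega
    calc (2 * k + 1).choose l ^ 2 * (2 * k + 1) ≤ (2 * k.centralBinom) ^ 2 * (2 * k + 1) := by
          gcongr
      _ = 4 * (k.centralBinom ^ 2 * (2 * k + 1)) := by ring
      _ ≤ 4 * 16 ^ k := by gcongr; exact centralBinom_sq_mul_le k
      _ = 4 ^ (2 * k + 1) := by rw [pow_succ, pow_mul]; norm_num; ring

/-- The variance of a fair binomial variable, read off from the Bernstein polynomials at `1 / 2`. -/
theorem sum_sq_sub_mul_choose (n : ℕ) :
    ∑ j ∈ Finset.range (n + 1), ((n : ℝ) - 2 * j) ^ 2 * (n.choose j : ℝ) = (n : ℝ) * 2 ^ n := by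
  have h := congrArg (Polynomial.eval (1 / 2 : ℝ)) (bernsteinPolynomial.variance ℝ n)
  simp only [bernsteinPolynomial, Polynomial.eval_finsetSum, nsmul_eq_mul] at h
  simp only [Polynomial.eval_mul, Polynomial.eval_pow, Polynomial.eval_sub, Polynomial.eval_natCast,
    Polynomial.eval_X, Polynomial.eval_one] at h
  have h2 : (2 : ℝ) ^ n ≠ 0 := by positivity
  have h3 : ∀ j ∈ Finset.range (n + 1), ((n : ℝ) - 2 * j) ^ 2 * (n.choose j : ℝ) =
      4 * 2 ^ n * ((n * (1 / 2 : ℝ) - j) ^ 2 *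
        (n.choose j * (1 / 2) ^ j * (1 - 1 / 2) ^ (n - j))) := by
    intro j hj
    rw [Finset.mem_range] at hj
    have : ((1 : ℝ) / 2) ^ j * (1 - 1 / 2) ^ (n - j) = 1 / 2 ^ n := by
      rw [show (1 : ℝ) - 1 / 2 = 1 / 2 by norm_num, ← pow_add, Nat.add_sub_cancel' (by omega),
        one_div_pow]
    rw [mul_assoc (n.choose j : ℝ), this]
    field_simp
    ring
  rw [Finset.sum_congr rfl h3, ← Finset.mul_sum, h]
  ring

theorem sum_sq_sub_weight (n : ℕ) :
    ∑ x : Cube n, ((n : ℝ) - 2 * weight x) ^ 2 = (n : ℝ) * 2 ^ n := by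
  rw [← sum_sq_sub_mul_choose, ← Finset.sum_fiberwise_of_maps_to
    (t := Finset.range (n + 1)) (g := weight)
    (fun x _ => Finset.mem_range.2 (Nat.lt_succ_of_le (weight_le x)))]
  refine Finset.sum_congr rfl fun j _ => ?_
  rw [← card_layer, mul_comm, ← nsmul_eq_mul, ← Finset.sum_const]
  refine Finset.sum_congr rfl fun x hx => ?_
  rw [(Finset.mem_filter.1 hx).2]

/-- Chebyshev's inequality for the Hamming weight. -/
theorem mul_card_le_of_weight_far {n : ℕ} {S : Finset (Cube n)} (hn : 0 < n)
    (hS : ∀ x ∈ S, (n : ℝ) / 2 ≤ |(n : ℝ) - 2 * weight x|) :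
    n * S.card ≤ 4 * 2 ^ n := by
  have h1 : (S.card : ℝ) * ((n : ℝ) / 2) ^ 2 ≤ n * 2 ^ n := by
    rw [← sum_sq_sub_weight, ← nsmul_eq_mul, ← Finset.sum_const]
    refine (Finset.sum_le_sum fun x hx => ?_).trans
      (Finset.sum_le_sum_of_subset_of_nonneg (Finset.subset_univ S) fun _ _ _ => sq_nonneg _)
    rw [← sq_abs ((n : ℝ) - 2 * weight x)]
    exact pow_le_pow_left₀ (by positivity) (hS x hx) 2
  have hn0 : (0 : ℝ) < n := by exact_mod_cast hn
  have h2 : (n : ℝ) * S.card ≤ 4 * 2 ^ n := by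
    refine le_of_mul_le_mul_left ?_ hn0
    linarith
  exact_mod_cast h2

theorem mul_card_below_le {n l : ℕ} (hn : 0 < n) (hl : 4 * l ≤ n) :
    n * (below n (l + 1)).card ≤ 4 * 2 ^ n := by
  refine mul_card_le_of_weight_far hn fun x hx => ?_
  rw [mem_below] at hx
  refine le_trans ?_ (le_abs_self _)
  have h1 : (4 : ℝ) * weight x ≤ n := by exact_mod_cast (by omega : 4 * weight x ≤ n)
  linarith

theorem mul_card_compl_below_le {n l : ℕ} (hn : 0 < n) (hl : 3 * n ≤ 4 * l) :
    n * (2 ^ n - (below n l).card) ≤ 4 * 2 ^ n := by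
  have h : (below n l)ᶜ.card = 2 ^ n - (below n l).card := by
    rw [Finset.card_compl]; simp
  rw [← h]
  refine mul_card_le_of_weight_far hn fun x hx => ?_
  rw [Finset.mem_compl, mem_below] at hx
  refine le_trans ?_ (neg_le_abs _)
  have h1 : (3 : ℝ) * n ≤ 4 * weight x := by exact_mod_cast (by omega : 3 * n ≤ 4 * weight x)
  linarith

/-- Ten steps give a neighbourhood of order `n ^ 10`; the constants are absorbed into one factor
`n`, which is why `n` must be huge. The target `32 * n ^ 9` makes a relative error `1 / n ^ 4` fail
with probability at most `2 * exp (-8 n)`. -/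
theorem choose_ten_ge {n k : ℕ} (hn : 2 ^ 60 ≤ n) (hk : n ≤ 4 * k) :
    32 * n ^ 9 ≤ k.choose 10 := by
  have h := Nat.pow_le_choose (α := ℝ) 10 k
  have h1 : (n : ℝ) / 8 ≤ ((k + 1 - 10 : ℕ) : ℝ) := by
    rw [div_le_iff₀ (by norm_num)]
    exact_mod_cast (by omega : n ≤ (k + 1 - 10) * 8)
  have hn' : (2 : ℝ) ^ 60 ≤ n := by exact_mod_cast hn
  have h2 : (32 * n ^ 9 : ℝ) ≤ ((k + 1 - 10 : ℕ) : ℝ) ^ 10 / (Nat.factorial 10 : ℕ) := by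
    have h3 : ((n : ℝ) / 8) ^ 10 ≤ ((k + 1 - 10 : ℕ) : ℝ) ^ 10 := by gcongr
    rw [le_div_iff₀ (by positivity)]
    refine le_trans ?_ h3
    have h4 : (Nat.factorial 10 : ℝ) ≤ 2 ^ 22 := by norm_num [Nat.factorial]
    calc (32 * n ^ 9 : ℝ) * (Nat.factorial 10 : ℕ) ≤ 32 * n ^ 9 * 2 ^ 22 := by gcongr
      _ = n ^ 9 * 2 ^ 27 := by ring
      _ ≤ n ^ 9 * (n / 8 ^ 10) := by
          gcongr
          rw [le_div_iff₀ (by positivity)]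
          refine le_trans ?_ hn'
          norm_num
      _ = (n / 8) ^ 10 := by ring
  exact_mod_cast h2.trans h

/-! ### Well-spread orderings and the union bound -/

open scoped Classical in
/-- The points of the layer of weight `l` that are comparable to `x`. -/
noncomputable def nbhd {n : ℕ} (x : Cube n) (l : ℕ) : Finset (Cube n) :=
  (layer n l).filter fun y => x ≤ y ∨ y ≤ x

open scoped Classical in
theorem nbhd_subset {n : ℕ} (x : Cube n) (l : ℕ) : nbhd x l ⊆ layer n l :=
  fun _ hy => (Finset.mem_filter.1 hy).1

open scoped Classical in
theorem nbhd_of_lt {n l : ℕ} {x : Cube n} (h : weight x < l) :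
    nbhd x l = (layer n l).filter fun y => x ≤ y := by
  refine Finset.filter_congr fun y hy => ?_
  rw [mem_layer] at hy
  exact ⟨fun h1 => h1.resolve_right fun h2 => by have := weight_mono h2; omega, Or.inl⟩

open scoped Classical in
theorem nbhd_of_gt {n l : ℕ} {x : Cube n} (h : l < weight x) :
    nbhd x l = (layer n l).filter fun y => y ≤ x := by
  refine Finset.filter_congr fun y hy => ?_
  rw [mem_layer] at hy
  exact ⟨fun h1 => h1.resolve_left fun h2 => by have := weight_mono h2; omega, Or.inr⟩

/-- Every initial segment of the ordering contains the expected proportion of every large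
neighbourhood, up to a small error. -/
def WellSpread {n : ℕ} (π : Cube n ≃ Fin (2 ^ n)) : Prop :=
  ∀ t ≤ 2 ^ n, ∀ x : Cube n, ∀ l ≤ n, 32 * n ^ 9 ≤ (nbhd x l).card →
    |((nbhd x l ∩ before π t).card : ℝ) - cutCount n l t / n.choose l * (nbhd x l).card| ≤
      1 / (n : ℝ) ^ 4 * (nbhd x l).card

open scoped Classical in
theorem card_not_wellSpread_le {n : ℕ} (hn : 0 < n) :
    (((layerOrderingsFinset n).filter fun π => ¬ WellSpread π).card : ℝ) ≤
      (1 / 2) ^ n * (layerOrderingsFinset n).card := by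
  set T := Finset.range (2 ^ n + 1) ×ˢ (Finset.univ : Finset (Cube n)) ×ˢ Finset.range (n + 1)
    with hT
  set bad : ℕ × Cube n × ℕ → Finset (Cube n ≃ Fin (2 ^ n)) := fun a =>
    (layerOrderingsFinset n).filter fun π => 32 * n ^ 9 ≤ (nbhd a.2.1 a.2.2).card ∧
      1 / (n : ℝ) ^ 4 * (nbhd a.2.1 a.2.2).card <
        |((nbhd a.2.1 a.2.2 ∩ before π a.1).card : ℝ) -
          cutCount n a.2.2 a.1 / n.choose a.2.2 * (nbhd a.2.1 a.2.2).card| with hbad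
  have hsub : ((layerOrderingsFinset n).filter fun π => ¬ WellSpread π) ⊆ T.biUnion bad := by
    intro π hπ
    rw [Finset.mem_filter] at hπ
    have h := hπ.2
    unfold WellSpread at h
    push Not at h
    obtain ⟨t, ht, x, l, hl, h1, h2⟩ := h
    rw [Finset.mem_biUnion]
    refine ⟨(t, x, l), ?_, Finset.mem_filter.2 ⟨hπ.1, h1, h2⟩⟩
    simp only [hT, Finset.mem_product, Finset.mem_range, Finset.mem_univ, true_and]
    omega
  have hn0 : (0 : ℝ) < n := by exact_mod_cast hn
  have hn1 : (1 : ℝ) ≤ n := by exact_mod_cast hn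
  -- Here `ε ^ 2 * |N| / 4` is at least `n ^ (-8) * 32 * n ^ 9 / 4 = 8 * n`.
  have hbound : ∀ a ∈ T, ((bad a).card : ℝ) ≤
      2 * (layerOrderingsFinset n).card * Real.exp (-(8 * n)) := by
    rintro ⟨t, x, l⟩ ha
    simp only [hT, Finset.mem_product, Finset.mem_range, Finset.mem_univ, true_and] at ha
    by_cases hc : 32 * n ^ 9 ≤ (nbhd x l).card
    · have hε : (1 : ℝ) / n ^ 4 ≤ 1 := by
        rw [div_le_one (by positivity)]
        exact one_le_pow₀ hn1
      refine (le_trans ?_ (card_before_deviation_le (l := l) (t := t) (by omega) (by omega)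
        (nbhd x l) (nbhd_subset x l) (ε := 1 / n ^ 4) (by positivity) hε)).trans ?_
      · refine Nat.cast_le.2 (Finset.card_le_card fun π hπ => ?_)
        simp only [hbad, Finset.mem_filter] at hπ ⊢
        exact ⟨hπ.1, hπ.2.2⟩
      · have hc' : (32 * n ^ 9 : ℝ) ≤ (nbhd x l).card := by exact_mod_cast hc
        refine mul_le_mul_of_nonneg_left ?_ (by positivity)
        rw [Real.exp_le_exp, neg_le_neg_iff, le_div_iff₀ (by norm_num)]
        calc (8 * n : ℝ) * 4 = (1 / n ^ 4) ^ 2 * (32 * n ^ 9) := by field_simp; ring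
          _ ≤ _ := by gcongr
    · have : bad (t, x, l) = ∅ := Finset.filter_eq_empty_iff.2 fun π _ h => hc h.1
      rw [this]
      simp only [Finset.card_empty, Nat.cast_zero]
      positivity
  have hcard : (T.card : ℝ) ≤ 2 * 8 ^ n := by
    have h1 : T.card = (2 ^ n + 1) * (2 ^ n * (n + 1)) := by
      simp [hT, Finset.card_product]
    have h2 : n + 1 ≤ 2 ^ n := Nat.lt_two_pow_self
    have h3 : T.card ≤ 2 * 8 ^ n := by
      rw [h1, show 2 * 8 ^ n = (2 ^ n + 2 ^ n) * (2 ^ n * 2 ^ n) by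
        rw [show 8 = 2 * 2 * 2 by norm_num, mul_pow, mul_pow]; ring]
      gcongr
      exact Nat.one_le_two_pow
    exact_mod_cast h3
  -- Since `e ≥ 2`, the exponential is at most `2 ^ (-8 n)`, which beats the number of events.
  have hexp : 4 * 8 ^ n * Real.exp (-(8 * n)) ≤ (1 / 2) ^ n := by
    have h1 : (2 : ℝ) ≤ Real.exp 1 := by have := Real.add_one_le_exp (1 : ℝ); linarith
    have h2 : (2 : ℝ) ^ (8 * n) ≤ Real.exp (8 * n) := by
      have := pow_le_pow_left₀ (by norm_num) h1 (8 * n)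
      rwa [← Real.exp_nat_mul, mul_one, Nat.cast_mul] at this
    rw [Real.exp_neg, ← div_eq_mul_inv, div_le_iff₀ (Real.exp_pos _)]
    refine le_trans ?_ (mul_le_mul_of_nonneg_left h2 (by positivity))
    have h4 : (4 : ℝ) ≤ 16 ^ n := by
      calc (4 : ℝ) ≤ 16 ^ 1 := by norm_num
        _ ≤ 16 ^ n := pow_le_pow_right₀ (by norm_num) hn
    calc (4 : ℝ) * 8 ^ n ≤ 16 ^ n * 8 ^ n := by gcongr
      _ = (1 / 2) ^ n * 2 ^ (8 * n) := by rw [pow_mul, ← mul_pow, ← mul_pow]; norm_num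
  calc (((layerOrderingsFinset n).filter fun π => ¬ WellSpread π).card : ℝ)
      ≤ ∑ a ∈ T, ((bad a).card : ℝ) := by
        exact_mod_cast (Finset.card_le_card hsub).trans Finset.card_biUnion_le
    _ ≤ T.card * (2 * (layerOrderingsFinset n).card * Real.exp (-(8 * n))) := by
        rw [← nsmul_eq_mul]; exact Finset.sum_le_card_nsmul _ _ _ hbound
    _ ≤ 2 * 8 ^ n * (2 * (layerOrderingsFinset n).card * Real.exp (-(8 * n))) := by gcongr
    _ = 4 * 8 ^ n * Real.exp (-(8 * n)) * (layerOrderingsFinset n).card := by ring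
    _ ≤ _ := by gcongr

/-! ### Admissible cuts and the standing assumptions -/

/-- A cut is admissible if it is trivial or leaves a fraction at least `1 / (2m)` of the cube
on both sides. -/
def InnerCut (n m t : ℕ) : Prop := 2 ^ n ≤ 2 * m * t ∧ 2 ^ n ≤ 2 * m * (2 ^ n - t)

/-- By Chebyshev, weights up to `n / 4` carry a fraction at most `4 / n` of the cube, less than the
`1 / (2m)` below an inner cut. Together with the mirror statement that follows, this puts any layer
split by an inner cut in the middle range. -/
theorem InnerCut.lt_four_mul {n m t l : ℕ} (h : InnerCut n m t) (hnm : 8 * m < n)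
    (hl : t < (below n (l + 1)).card) : n < 4 * l := by
  by_contra! hc
  have h1 := mul_card_below_le (by omega : 0 < n) hc
  have h2 : 2 ^ n * n ≤ 2 ^ n * (8 * m) := by
    calc 2 ^ n * n ≤ 2 * m * t * n := Nat.mul_le_mul_right _ h.1
      _ ≤ 2 * m * (below n (l + 1)).card * n := by gcongr
      _ = 2 * m * (n * (below n (l + 1)).card) := by ring
      _ ≤ 2 * m * (4 * 2 ^ n) := Nat.mul_le_mul_left _ h1
      _ = 2 ^ n * (8 * m) := by ring
  have := Nat.le_of_mul_le_mul_left h2 (by positivity)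
  omega

theorem InnerCut.four_mul_lt {n m t l : ℕ} (h : InnerCut n m t) (hnm : 8 * m < n)
    (hl : (below n l).card ≤ t) : 4 * l < 3 * n := by
  by_contra! hc
  have h1 := mul_card_compl_below_le (by omega : 0 < n) hc
  have h2 : 2 ^ n * n ≤ 2 ^ n * (8 * m) := by
    calc 2 ^ n * n ≤ 2 * m * (2 ^ n - t) * n := Nat.mul_le_mul_right _ h.2
      _ ≤ 2 * m * (2 ^ n - (below n l).card) * n := by gcongr
      _ = 2 * m * (n * (2 ^ n - (below n l).card)) := by ring
      _ ≤ 2 * m * (4 * 2 ^ n) := Nat.mul_le_mul_left _ h1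
      _ = 2 ^ n * (8 * m) := by ring
  have := Nat.le_of_mul_le_mul_left h2 (by positivity)
  omega

/-- The standing assumptions on an ordering and on the parameters. -/
structure Setting {n : ℕ} (m : ℕ) (π : Cube n ≃ Fin (2 ^ n)) : Prop where
  mem : π ∈ layerOrderings n
  spread : WellSpread π
  large : 2 ^ 60 ≤ n
  pos : 0 < m
  param : (320 * m) ^ 2 ≤ n

theorem Setting.mul_lt {n m : ℕ} {π : Cube n ≃ Fin (2 ^ n)} (h : Setting m π) :
    320 * m ≤ n := by
  have := h.param
  have := h.pos
  nlinarith

/-- The cuts that are used: the two trivial ones and the inner ones. -/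
def IsCut (n m t : ℕ) : Prop := t ≤ 2 ^ n ∧ (t = 0 ∨ t = 2 ^ n ∨ InnerCut n m t)

theorem card_below_le (n l : ℕ) : (below n l).card ≤ 2 ^ n := by
  simpa using Finset.card_le_univ (below n l)

theorem card_nbhd_up {n : ℕ} {x : Cube n} {l : ℕ} (h : weight x + 10 = l) :
    (nbhd x l).card = (n - weight x).choose 10 := by
  rw [nbhd_of_lt (by omega), ← h]
  exact card_layer_filter_ge rfl

theorem card_nbhd_down {n : ℕ} {x : Cube n} {l : ℕ} (h : weight x = l + 10) :
    (nbhd x l).card = (weight x).choose 10 := by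
  rw [nbhd_of_gt (by omega), card_layer_filter_le rfl, h, Nat.choose_symm_add]

/-- A layer wholly inside or outside the initial segment has no error. A layer that is split forces
the cut to be inner, so its weight is in the middle range and the ten-step neighbourhood is large
enough for `WellSpread`. -/
theorem Setting.abs_before_sub_le {n m t l : ℕ} {π : Cube n ≃ Fin (2 ^ n)} (h : Setting m π)
    (ht : IsCut n m t) (hl : l ≤ n) {x : Cube n} (hx : weight x + 10 = l ∨ weight x = l + 10) :
    |((nbhd x l ∩ before π t).card : ℝ) - cutCount n l t / n.choose l * (nbhd x l).card| ≤
      1 / (n : ℝ) ^ 4 * (nbhd x l).card := by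
  have hnm := h.mul_lt
  have hm := h.pos
  have hc0 : (n.choose l : ℝ) ≠ 0 := by exact_mod_cast (Nat.choose_pos hl).ne'
  rcases le_or_gt (below n (l + 1)).card t with h1 | h1
  · have hsub : layer n l ⊆ before π t := fun y hy =>
      below_subset_before h.mem ht.1 h1 (mem_below.2 (by rw [mem_layer.1 hy]; omega))
    have h2 : cutCount n l t = n.choose l := by
      rw [← card_before_inter_layer h.mem l ht.1, Finset.inter_eq_right.2 hsub, card_layer]
    rw [h2, div_self hc0, Finset.inter_eq_left.2 ((nbhd_subset x l).trans hsub), one_mul, sub_self,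
      abs_zero]
    positivity
  rcases le_or_gt t (below n l).card with h3 | h3
  · have hdis : Disjoint (layer n l) (before π t) := Finset.disjoint_left.2 fun y hy hyt => by
      have := mem_below.1 (before_subset_below h.mem ht.1 h3 hyt)
      rw [mem_layer] at hy
      omega
    have h2 : cutCount n l t = 0 := by
      rw [← card_before_inter_layer h.mem l ht.1, Finset.card_eq_zero]
      exact Finset.disjoint_iff_inter_eq_empty.1 hdis.symm
    rw [h2, Finset.disjoint_iff_inter_eq_empty.1 (Finset.disjoint_of_subset_left
      (nbhd_subset x l) hdis)]
    simp only [Finset.card_empty, Nat.cast_zero, zero_div, zero_mul, sub_self, abs_zero]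
    positivity
  have hin : InnerCut n m t := by
    have := card_below_le n (l + 1)
    rcases ht.2 with h4 | h4 | h4
    · omega
    · omega
    · exact h4
  have h5 := hin.lt_four_mul (by omega) h1
  have h6 := hin.four_mul_lt (by omega) h3.le
  refine h.spread t ht.1 x l hl ?_
  rcases hx with hx | hx
  · rw [card_nbhd_up hx]
    exact choose_ten_ge h.large (by omega)
  · rw [card_nbhd_down hx]
    exact choose_ten_ge h.large (by omega)

/-! ### Up-sets inside a block, layer by layer -/

/-- The points at positions `s, …, t - 1`. -/
def block {n : ℕ} (π : Cube n ≃ Fin (2 ^ n)) (s t : ℕ) : Finset (Cube n) := before π t \ before π s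

theorem mem_block {n s t : ℕ} {π : Cube n ≃ Fin (2 ^ n)} {x : Cube n} :
    x ∈ block π s t ↔ s ≤ (π x : ℕ) ∧ (π x : ℕ) < t := by
  simp only [block, Finset.mem_sdiff, mem_before]
  omega

theorem card_block {n s t : ℕ} (π : Cube n ≃ Fin (2 ^ n)) (hst : s ≤ t) (ht : t ≤ 2 ^ n) :
    (block π s t).card = t - s := by
  rw [block, Finset.card_sdiff_of_subset (before_mono π hst), card_before π ht,
    card_before π (hst.trans ht)]

theorem card_inter_block {n s t : ℕ} (π : Cube n ≃ Fin (2 ^ n)) (hst : s ≤ t)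
    (N : Finset (Cube n)) :
    ((N ∩ block π s t).card : ℝ) = (N ∩ before π t).card - (N ∩ before π s).card := by
  rw [eq_sub_iff_add_eq]
  have h := Finset.card_inter_add_card_sdiff (N ∩ before π t) (before π s)
  have h1 : N ∩ before π t ∩ before π s = N ∩ before π s := by
    rw [Finset.inter_assoc, Finset.inter_eq_right.2 (before_mono π hst)]
  have h2 : (N ∩ before π t) \ before π s = N ∩ block π s t := by
    rw [block, Finset.inter_sdiff_assoc]
  rw [h1, h2, add_comm] at h
  exact_mod_cast h

/-- A block is a difference of two initial segments, so the errors add up to `2 / n ^ 4`. -/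
theorem Setting.abs_block_sub_le {n m s t l : ℕ} {π : Cube n ≃ Fin (2 ^ n)} (h : Setting m π)
    (hs : IsCut n m s) (ht : IsCut n m t) (hst : s ≤ t) (hl : l ≤ n) {x : Cube n}
    (hx : weight x + 10 = l ∨ weight x = l + 10) :
    |((nbhd x l ∩ block π s t).card : ℝ) -
        (layer n l ∩ block π s t).card / n.choose l * (nbhd x l).card| ≤
      2 / (n : ℝ) ^ 4 * (nbhd x l).card := by
  have h1 := h.abs_before_sub_le hs hl hx
  have h2 := h.abs_before_sub_le ht hl hx
  rw [card_inter_block π hst, card_inter_block π hst, Finset.inter_comm (layer n l),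
    Finset.inter_comm (layer n l), card_before_inter_layer h.mem l hs.1,
    card_before_inter_layer h.mem l ht.1, sub_div, sub_mul]
  rw [abs_le] at h1 h2 ⊢
  have h3 : 2 / (n : ℝ) ^ 4 * (nbhd x l).card = 1 / (n : ℝ) ^ 4 * (nbhd x l).card +
    1 / (n : ℝ) ^ 4 * (nbhd x l).card := by ring
  rw [h3]
  constructor <;> linarith

/-- Everything above a point of `U` is in `U`, so the biregular estimate applies to layers `l` and
`l + 10`, where neighbourhoods are evenly sampled by the block. -/
theorem Setting.card_layer_inter_le {n m s t l : ℕ} {π : Cube n ≃ Fin (2 ^ n)} (h : Setting m π)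
    (hs : IsCut n m s) (ht : IsCut n m t) (hst : s ≤ t) (hl : l + 10 ≤ n) {U : Finset (Cube n)}
    (hU : IsUpperSet (U : Set (Cube n))) {M : ℝ} (hM : density U (l + 10) ≤ M) (hM1 : M ≤ 1) :
    ((U ∩ (layer n l ∩ block π s t)).card : ℝ) ≤ (layer n l ∩ block π s t).card * M +
      2 / (n : ℝ) ^ 4 * n.choose l * min M (1 - M) := by
  classical
  have hc0 : (n.choose l : ℝ) ≠ 0 := by exact_mod_cast (Nat.choose_pos (by omega)).ne'
  rw [← card_layer]
  refine card_inter_le_of_biregular (layer n l) (layer n l ∩ block π s t) U (layer n (l + 10))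
    (U ∩ layer n (l + 10)) (fun x y => x ≤ y) (D := (n - l).choose 10) (D' := (l + 10).choose l)
    (p := (layer n l ∩ block π s t).card / n.choose l)
    (Nat.choose_pos (by omega)) (fun x hx => ?_) (fun y hy => ?_) Finset.inter_subset_left
    (by rw [card_layer, div_mul_cancel₀ _ hc0]) (fun y hy => ?_) (by positivity)
    Finset.inter_subset_right
    (fun x _ y hy hxy hxU => Finset.mem_inter.2 ⟨hU hxy hxU, hy⟩) ?_ hM1
  · convert card_layer_filter_ge (mem_layer.1 hx)
  · convert card_layer_filter_le (mem_layer.1 hy)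
  · rw [mem_layer] at hy
    have h1 := h.abs_block_sub_le hs ht hst (l := l) (by omega) (Or.inr hy)
    rw [nbhd_of_gt (by omega), card_layer_filter_le hy] at h1
    convert h1 using 5
    ext x
    simp only [Finset.mem_filter, Finset.mem_inter]
    tauto
  · rw [← density_mul U hl, card_layer]
    gcongr

/-- The mirror image: the complement of `U` is closed downwards, so the layer ten steps below
controls it. -/
theorem Setting.card_layer_inter_ge {n m s t l : ℕ} {π : Cube n ≃ Fin (2 ^ n)} (h : Setting m π)
    (hs : IsCut n m s) (ht : IsCut n m t) (hst : s ≤ t) (hl : l + 10 ≤ n) {U : Finset (Cube n)}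
    (hU : IsUpperSet (U : Set (Cube n))) {M : ℝ} (hM : M ≤ density U l) (hM0 : 0 ≤ M) :
    ((layer n (l + 10) ∩ block π s t).card : ℝ) * M -
      2 / (n : ℝ) ^ 4 * n.choose (l + 10) * min M (1 - M) ≤
        (U ∩ (layer n (l + 10) ∩ block π s t)).card := by
  classical
  have hc0 : (n.choose (l + 10) : ℝ) ≠ 0 := by exact_mod_cast (Nat.choose_pos hl).ne'
  have key := card_inter_le_of_biregular (layer n (l + 10)) (layer n (l + 10) ∩ block π s t) Uᶜ
    (layer n l) (Uᶜ ∩ layer n l) (fun x y => y ≤ x) (D := (l + 10).choose l)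
    (D' := (n - l).choose 10)
    (p := (layer n (l + 10) ∩ block π s t).card / n.choose (l + 10)) (ε := 2 / (n : ℝ) ^ 4)
    (M := 1 - M)
    (Nat.choose_pos (by omega)) (fun x hx => by convert card_layer_filter_le (mem_layer.1 hx))
    (fun y hy => by convert card_layer_filter_ge (mem_layer.1 hy)) Finset.inter_subset_left
    (by rw [card_layer, div_mul_cancel₀ _ hc0])
    (fun y hy => by
      rw [mem_layer] at hy
      have h1 := h.abs_block_sub_le hs ht hst (l := l + 10) hl (Or.inl (by rw [hy] : _ = l + 10))
      rw [nbhd_of_lt (by omega), card_layer_filter_ge hy] at h1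
      convert h1 using 5
      ext x
      simp only [Finset.mem_filter, Finset.mem_inter]
      tauto) (by positivity) Finset.inter_subset_right
    (fun x _ y hy hxy hxU => Finset.mem_inter.2
      ⟨Finset.mem_compl.2 fun h => Finset.mem_compl.1 hxU (hU hxy h), hy⟩)
    (by
      rw [← density_mul _ (by omega), card_layer, density_compl _ (by omega)]
      gcongr) (by linarith)
  rw [card_layer, sub_sub_cancel, min_comm (1 - M)] at key
  have h2 := Finset.card_inter_add_card_sdiff (layer n (l + 10) ∩ block π s t) U
  have h3 : Uᶜ ∩ (layer n (l + 10) ∩ block π s t) = (layer n (l + 10) ∩ block π s t) \ U := by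
    ext x; simp only [Finset.mem_inter, Finset.mem_compl, Finset.mem_sdiff]; tauto
  rw [h3] at key
  rw [Finset.inter_comm _ U] at h2
  have h4 : ((U ∩ (layer n (l + 10) ∩ block π s t)).card : ℝ) +
    ((layer n (l + 10) ∩ block π s t) \ U).card = (layer n (l + 10) ∩ block π s t).card := by
    exact_mod_cast h2
  linarith

theorem sum_card_layer_inter {n : ℕ} (S : Finset (Cube n)) :
    ∑ l ∈ Finset.range (n + 1), ((layer n l ∩ S).card : ℝ) = S.card := by
  have h := Finset.card_eq_sum_card_fiberwise (s := S) (t := Finset.range (n + 1)) (f := weight)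
    (fun x _ => by simpa using Nat.lt_succ_of_le (weight_le x))
  rw [h, Nat.cast_sum]
  refine Finset.sum_congr rfl fun l _ => ?_
  congr 2
  ext x
  simp [mem_layer, and_comm]

theorem sum_choose_real (n : ℕ) : ∑ l ∈ Finset.range (n + 1), (n.choose l : ℝ) = 2 ^ n := by
  exact_mod_cast Nat.sum_range_choose n

theorem card_layer_inter_le_choose {n l : ℕ} (S : Finset (Cube n)) :
    (layer n l ∩ S).card ≤ n.choose l :=
  card_layer n l ▸ Finset.card_le_card Finset.inter_subset_left

theorem sum_window_le {n a : ℕ} {c : ℝ} (hc : 0 ≤ c) :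
    ∑ l ∈ Finset.range (n + 1), (if a ≤ l ∧ l < a + 20 then c else 0) ≤ 20 * c := by
  rw [← Finset.sum_filter, Finset.sum_const, nsmul_eq_mul]
  refine mul_le_mul_of_nonneg_right ?_ hc
  have : ((Finset.range (n + 1)).filter fun l => a ≤ l ∧ l < a + 20) ⊆ Finset.Ico a (a + 20) :=
    fun l hl => by
      rw [Finset.mem_filter] at hl
      exact Finset.mem_Ico.2 hl.2
  have := Finset.card_le_card this
  rw [Nat.card_Ico, Nat.add_sub_cancel_left] at this
  exact_mod_cast this

theorem min_one_sub_le {M M' : ℝ} (h : M ≤ M') :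
    min M' (1 - M') ≤ min M (1 - M) + (M' - M) := by
  rcases min_choice M (1 - M) with h1 | h1 <;> rw [h1]
  · linarith [min_le_left M' (1 - M')]
  · linarith [min_le_right M' (1 - M')]

/-- A layer of weight at most `b - 20` is controlled by a layer of density at most `density U (b -
10)`. The twenty layers from `b - 19` to `b` only see `density U (b + 10)`; each pays the increment
times its size, at most `K`. -/
theorem Setting.card_inter_block_le {n m s t b : ℕ} {π : Cube n ≃ Fin (2 ^ n)} (h : Setting m π)
    (hs : IsCut n m s) (ht : IsCut n m t) (hst : s ≤ t) (hb : 20 ≤ b) (hbn : b + 10 ≤ n)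
    (hw : ∀ x ∈ block π s t, weight x ≤ b) {U : Finset (Cube n)}
    (hU : IsUpperSet (U : Set (Cube n))) {K : ℝ} (hK : ∀ l, (n.choose l : ℝ) ≤ K) :
    ((U ∩ block π s t).card : ℝ) ≤ (block π s t).card * density U (b - 10) +
      (2 / (n : ℝ) ^ 4 * 2 ^ n * (min (density U (b - 10)) (1 - density U (b - 10)) +
        (density U (b + 10) - density U (b - 10))) +
      20 * (K * (density U (b + 10) - density U (b - 10)))) := by
  set M := density U (b - 10) with hMdef
  set M' := density U (b + 10) with hMdef'
  set m₀ := min M (1 - M) with hm₀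
  have hMM : M ≤ M' := density_mono hU (by omega) hbn
  have hM0 : 0 ≤ M := density_nonneg U
  have hM1' : M' ≤ 1 := density_le_one U
  have hm0 : 0 ≤ m₀ := le_min hM0 (by linarith)
  have hK0 : 0 ≤ K := le_trans (Nat.cast_nonneg _) (hK 0)
  have hlayer : ∀ l ∈ Finset.range (n + 1), ((layer n l ∩ (U ∩ block π s t)).card : ℝ) ≤
      (layer n l ∩ block π s t).card * M + 2 / (n : ℝ) ^ 4 * n.choose l * (m₀ + (M' - M)) +
        (if b - 19 ≤ l ∧ l < b - 19 + 20 then K * (M' - M) else 0) := by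
    intro l hl
    have hcomm : layer n l ∩ (U ∩ block π s t) = U ∩ (layer n l ∩ block π s t) := by
      ext x; simp only [Finset.mem_inter]; tauto
    rw [hcomm]
    have hε : 0 ≤ 2 / (n : ℝ) ^ 4 * n.choose l := by positivity
    have hwin : 0 ≤ (if b - 19 ≤ l ∧ l < b - 19 + 20 then K * (M' - M) else 0) := by
      split_ifs
      · exact mul_nonneg hK0 (by linarith)
      · exact le_rfl
    rcases lt_or_ge b l with hbl | hbl
    · have hem : layer n l ∩ block π s t = ∅ := by
        rw [Finset.eq_empty_iff_forall_notMem]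
        intro x hx
        rw [Finset.mem_inter, mem_layer] at hx
        have := hw x hx.2
        omega
      rw [hem]
      simp only [Finset.inter_empty, Finset.card_empty, Nat.cast_zero, zero_mul, zero_add]
      exact add_nonneg (mul_nonneg hε (by linarith)) hwin
    · rcases le_or_gt (l + 20) b with hl2 | hl2
      · have h1 := h.card_layer_inter_le hs ht hst (l := l) (by omega) hU (M := M)
          (density_mono hU (by omega) (by omega)) (by linarith)
        have h2 : 2 / (n : ℝ) ^ 4 * n.choose l * m₀ ≤
          2 / (n : ℝ) ^ 4 * n.choose l * (m₀ + (M' - M)) :=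
          mul_le_mul_of_nonneg_left (by linarith) hε
        linarith
      · have h1 := h.card_layer_inter_le hs ht hst (l := l) (by omega) hU (M := M')
          (density_mono hU (by omega) (by omega)) hM1'
        have h2 := mul_le_mul_of_nonneg_left (min_one_sub_le hMM) hε
        have h3 : ((layer n l ∩ block π s t).card : ℝ) * (M' - M) ≤ K * (M' - M) :=
          mul_le_mul_of_nonneg_right
            ((Nat.cast_le.2 (card_layer_inter_le_choose _)).trans (hK l)) (by linarith)
        rw [if_pos (by omega)]
        linarith
  have hsum := Finset.sum_le_sum hlayer
  rw [sum_card_layer_inter, Finset.sum_add_distrib, Finset.sum_add_distrib, ← Finset.sum_mul,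
    sum_card_layer_inter, ← Finset.sum_mul, ← Finset.mul_sum, sum_choose_real] at hsum
  have := sum_window_le (n := n) (a := b - 19) (mul_nonneg hK0 (by linarith : 0 ≤ M' - M))
  linarith

/-- As for the upper bound, with the exceptional layers now `b` to `b + 19`. -/
theorem Setting.card_inter_block_ge {n m s t b : ℕ} {π : Cube n ≃ Fin (2 ^ n)} (h : Setting m π)
    (hs : IsCut n m s) (ht : IsCut n m t) (hst : s ≤ t) (hb : 20 ≤ b) (hbn : b + 10 ≤ n)
    (hw : ∀ x ∈ block π s t, b ≤ weight x) {U : Finset (Cube n)}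
    (hU : IsUpperSet (U : Set (Cube n))) {K : ℝ} (hK : ∀ l, (n.choose l : ℝ) ≤ K) :
    ((block π s t).card : ℝ) * density U (b + 10) -
      (2 / (n : ℝ) ^ 4 * 2 ^ n * (min (density U (b - 10)) (1 - density U (b - 10)) +
        (density U (b + 10) - density U (b - 10))) +
      20 * (K * (density U (b + 10) - density U (b - 10)))) ≤ (U ∩ block π s t).card := by
  set M := density U (b - 10) with hMdef
  set M' := density U (b + 10) with hMdef'
  set m₀ := min M (1 - M) with hm₀
  have hMM : M ≤ M' := density_mono hU (by omega) hbn
  have hM0 : 0 ≤ M := density_nonneg U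
  have hM1' : M' ≤ 1 := density_le_one U
  have hm0 : 0 ≤ m₀ := le_min hM0 (by linarith)
  have hK0 : 0 ≤ K := le_trans (Nat.cast_nonneg _) (hK 0)
  have hlayer : ∀ l ∈ Finset.range (n + 1),
      ((layer n l ∩ block π s t).card : ℝ) * M' ≤ (layer n l ∩ (U ∩ block π s t)).card +
        2 / (n : ℝ) ^ 4 * n.choose l * (m₀ + (M' - M)) +
        (if b ≤ l ∧ l < b + 20 then K * (M' - M) else 0) := by
    intro l hl
    rw [Finset.mem_range] at hl
    have hcomm : layer n l ∩ (U ∩ block π s t) = U ∩ (layer n l ∩ block π s t) := by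
      ext x; simp only [Finset.mem_inter]; tauto
    rw [hcomm]
    have hε : 0 ≤ 2 / (n : ℝ) ^ 4 * n.choose l := by positivity
    have hwin : 0 ≤ (if b ≤ l ∧ l < b + 20 then K * (M' - M) else 0) := by
      split_ifs
      · exact mul_nonneg hK0 (by linarith)
      · exact le_rfl
    rcases lt_or_ge l b with hbl | hbl
    · have hem : layer n l ∩ block π s t = ∅ := by
        rw [Finset.eq_empty_iff_forall_notMem]
        intro x hx
        rw [Finset.mem_inter, mem_layer] at hx
        have := hw x hx.2
        omega
      rw [hem]
      simp only [Finset.inter_empty, Finset.card_empty, Nat.cast_zero, zero_mul, zero_add]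
      exact add_nonneg (mul_nonneg hε (by linarith)) hwin
    · obtain ⟨k, rfl⟩ := Nat.exists_eq_add_of_le' (by omega : 10 ≤ l)
      rcases le_or_gt (b + 20) (k + 10) with hl2 | hl2
      · have h1 := h.card_layer_inter_ge hs ht hst (l := k) (by omega) hU (M := M')
          (density_mono hU (by omega) (by omega)) (by linarith)
        have h2 := mul_le_mul_of_nonneg_left (min_one_sub_le hMM) hε
        linarith
      · have h1 := h.card_layer_inter_ge hs ht hst (l := k) (by omega) hU (M := M)
          (density_mono hU (by omega) (by omega)) hM0
        have h2 : 2 / (n : ℝ) ^ 4 * n.choose (k + 10) * m₀ ≤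
          2 / (n : ℝ) ^ 4 * n.choose (k + 10) * (m₀ + (M' - M)) :=
          mul_le_mul_of_nonneg_left (by linarith) hε
        have h3 : ((layer n (k + 10) ∩ block π s t).card : ℝ) * (M' - M) ≤ K * (M' - M) :=
          mul_le_mul_of_nonneg_right
            ((Nat.cast_le.2 (card_layer_inter_le_choose _)).trans (hK _)) (by linarith)
        rw [if_pos (by omega)]
        linarith
  have hsum := Finset.sum_le_sum hlayer
  rw [← Finset.sum_mul, sum_card_layer_inter, Finset.sum_add_distrib, Finset.sum_add_distrib,
    sum_card_layer_inter, ← Finset.sum_mul, ← Finset.mul_sum, sum_choose_real] at hsum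
  have := sum_window_le (n := n) (a := b) (mul_nonneg hK0 (by linarith : 0 ≤ M' - M))
  linarith

/-! ### The surplus of an up-set in the next block -/

/-- Here `k` is a block size, `K` a bound on layer sizes, `W` the size of the cube. All losses are
multiples of `k * Δ`: the doubled coefficients of `hW1`, `hW2` and `hK1` sum to `3 / 8`. So at least
`k / 2 * Δ` survives, and it remains to bound `Δ` below. -/
theorem gain_ge {n m k K W M M' : ℝ} (hm : 1 ≤ m) (hn : 320 * m ≤ n) (hW : W ≤ 2 * m * k)
    (hW0 : 0 < W) (hK : 320 * m * K = W) (hM0 : 0 ≤ M) (hMM : M ≤ M') (hM1 : M' ≤ 1)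
    (hexp : M * (1 - M) / n ^ 2 ≤ M' - M) (hlow : 32 * n ^ 9 ≤ M' * K)
    (hup : 32 * n ^ 9 ≤ (1 - M) * K) :
    m ≤ k * (M' - M) - 2 * (2 / n ^ 4 * W * (min M (1 - M) + (M' - M)) +
      20 * (K * (M' - M))) := by
  have hn0 : 0 < n := by linarith
  have hm0 : 0 < m := by linarith
  set Δ := M' - M with hΔ
  have hΔ0 : 0 ≤ Δ := by linarith
  have hk0 : 0 < k := by
    by_contra! h
    nlinarith
  have hKk : 160 * K ≤ k := by
    have : 2 * m * (160 * K) ≤ 2 * m * k := by linarith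
    exact le_of_mul_le_mul_left this (by positivity)
  have hK0 : 0 < K := by
    by_contra! h
    nlinarith
  have hmin : min M (1 - M) ≤ 2 * (M * (1 - M)) := by
    rcases le_total M (1 / 2) with h | h
    · refine (min_le_left _ _).trans ?_
      nlinarith
    · refine (min_le_right _ _).trans ?_
      nlinarith
  have hexp' : M * (1 - M) ≤ n ^ 2 * Δ := by
    rw [div_le_iff₀ (by positivity)] at hexp
    linarith
  have hmin2 : min M (1 - M) ≤ 2 * n ^ 2 * Δ := by linarith
  have hn1 : 320 ≤ n := by linarith
  have hmn2 : 320 * m ≤ n ^ 2 := by nlinarith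
  have hmn4 : 320 * m ≤ n ^ 4 := by nlinarith [sq_nonneg (n ^ 2 - 1)]
  have hW1 : 2 / n ^ 4 * W * Δ ≤ k / 80 * Δ := by
    refine mul_le_mul_of_nonneg_right ?_ hΔ0
    rw [div_mul_eq_mul_div, div_le_iff₀ (by positivity)]
    nlinarith
  have hW2 : 2 / n ^ 4 * W * min M (1 - M) ≤ k / 20 * Δ := by
    have h1 : 2 / n ^ 4 * W * min M (1 - M) ≤ 2 / n ^ 4 * W * (2 * n ^ 2 * Δ) :=
      mul_le_mul_of_nonneg_left hmin2 (by positivity)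
    have h2 : 2 / n ^ 4 * W * (2 * n ^ 2 * Δ) = (4 * W / n ^ 2) * Δ := by
      field_simp; ring
    have h3 : 4 * W / n ^ 2 ≤ k / 20 := by
      rw [div_le_iff₀ (by positivity)]
      nlinarith
    rw [h2] at h1
    exact h1.trans (mul_le_mul_of_nonneg_right h3 hΔ0)
  have hK1 : 20 * (K * Δ) ≤ k / 8 * Δ := by nlinarith
  -- If `M ≥ M' / 2`, then `M * (1 - M)` is bounded below by `hlow` or `hup`, and expansion bounds
  -- `Δ`. Otherwise `Δ ≥ M' / 2` outright.
  have hΔK : 8 * n ^ 7 ≤ Δ * K := by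
    have hMK : 32 * n ^ 9 ≤ 4 * n ^ 2 * (Δ * K) := by
      rcases le_total (M' / 2) M with h | h
      · have h1 : 32 * n ^ 9 ≤ 4 * (M * (1 - M)) * K := by
          rcases le_total M (1 / 2) with h2 | h2
          · have : M' ≤ 4 * (M * (1 - M)) := by nlinarith
            nlinarith
          · have : 1 - M ≤ 4 * (M * (1 - M)) := by nlinarith
            nlinarith
        have h2 := mul_le_mul_of_nonneg_right hexp' hK0.le
        linarith
      · have h1 : 32 * n ^ 9 ≤ 2 * (Δ * K) := by nlinarith
        have h2 : 1 ≤ n ^ 2 := by nlinarith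
        nlinarith [mul_nonneg hΔ0 hK0.le]
    have h1 : 4 * n ^ 2 * (8 * n ^ 7) ≤ 4 * n ^ 2 * (Δ * K) := by
      calc 4 * n ^ 2 * (8 * n ^ 7) = 32 * n ^ 9 := by ring
        _ ≤ _ := hMK
    exact le_of_mul_le_mul_left h1 (by positivity)
  have hfin : m ≤ k / 2 * Δ := by
    have h1 : 80 * (Δ * K) ≤ k / 2 * Δ := by nlinarith
    have h2 : n ≤ n ^ 7 := by
      calc n = n ^ 1 := (pow_one n).symm
        _ ≤ n ^ 7 := pow_le_pow_right₀ (by linarith) (by norm_num)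
    linarith
  linarith

theorem Setting.choose_le {n m : ℕ} {π : Cube n ≃ Fin (2 ^ n)} (h : Setting m π) (l : ℕ) :
    (n.choose l : ℝ) ≤ 2 ^ n / (320 * m) := by
  have hm : (0 : ℝ) < m := by exact_mod_cast h.pos
  rw [le_div_iff₀ (by positivity)]
  have h1 : (n.choose l * (320 * m)) ^ 2 ≤ (2 ^ n) ^ 2 := by
    calc (n.choose l * (320 * m)) ^ 2 = n.choose l ^ 2 * (320 * m) ^ 2 := by ring
      _ ≤ n.choose l ^ 2 * n := Nat.mul_le_mul_left _ h.param
      _ ≤ 4 ^ n := choose_sq_mul_le n l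
      _ = (2 ^ n) ^ 2 := by rw [← pow_mul, mul_comm, pow_mul]; norm_num
  exact_mod_cast (Nat.pow_le_pow_iff_left (by norm_num)).1 h1

theorem density_pos {n : ℕ} {U : Finset (Cube n)} {x : Cube n} (hx : x ∈ U) :
    0 < density U (weight x) := by
  have h1 : 0 < (U ∩ layer n (weight x)).card :=
    Finset.card_pos.2 ⟨x, Finset.mem_inter.2 ⟨hx, mem_layer.2 rfl⟩⟩
  have h2 : 0 < n.choose (weight x) := Nat.choose_pos (weight_le x)
  unfold density
  positivity

theorem exists_mem_of_density_pos {n l : ℕ} {U : Finset (Cube n)} (h : 0 < density U l) :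
    ∃ x ∈ U, weight x = l := by
  by_contra! hc
  have : U ∩ layer n l = ∅ := by
    rw [Finset.eq_empty_iff_forall_notMem]
    intro x hx
    rw [Finset.mem_inter, mem_layer] at hx
    exact hc x hx.1 hx.2
  rw [density, this] at h
  simp at h

theorem InnerCut.lt {n m t : ℕ} (h : InnerCut n m t) : t < 2 ^ n := by
  by_contra! hc
  have := h.2
  rw [Nat.sub_eq_zero_of_le hc, mul_zero] at this
  exact absurd this (Nat.two_pow_pos n).not_ge

/-- An up-set that meets a block but does not contain the next one has substantially more points
in the next block. -/
theorem Setting.card_inter_add_le {n m t₀ t₁ t₂ : ℕ} {π : Cube n ≃ Fin (2 ^ n)} (h : Setting m π)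
    (h₀ : IsCut n m t₀) (h₁ : InnerCut n m t₁) (h₂ : IsCut n m t₂) (h01 : t₀ ≤ t₁) (h12 : t₁ ≤ t₂)
    (hk : 2 ^ n ≤ 2 * m * (t₁ - t₀)) (hkk : t₁ - t₀ ≤ t₂ - t₁) {U : Finset (Cube n)}
    (hU : IsUpperSet (U : Set (Cube n))) {x y : Cube n} (hxU : x ∈ U) (hx : x ∈ block π t₀ t₁)
    (hyU : y ∉ U) (hy : y ∈ block π t₁ t₂) :
    (U ∩ block π t₀ t₁).card + m ≤ (U ∩ block π t₁ t₂).card := by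
  classical
  have hnm := h.mul_lt
  have hm := h.pos
  have hn := h.large
  have ht₁ := h₁.lt
  -- The first point of the upper block; its weight `b` separates the two blocks.
  set z := π.symm ⟨t₁, ht₁⟩ with hz
  have hπz : (π z : ℕ) = t₁ := by simp [hz]
  set b := weight z with hb
  have hb1 : t₁ < (below n (b + 1)).card := by
    by_contra! hc
    have := mem_before.1 (below_subset_before h.mem ht₁.le hc (mem_below.2 (Nat.lt_succ_self b)))
    omega
  have hb2 : (below n b).card ≤ t₁ := by
    by_contra! hc
    have := mem_below.1 (before_subset_below h.mem (t := t₁ + 1) (by omega) hc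
      (mem_before.2 (by omega : (π z : ℕ) < t₁ + 1)))
    omega
  have hlo := h₁.lt_four_mul (by omega) hb1
  have hhi := h₁.four_mul_lt (by omega) hb2
  have hwP : ∀ w ∈ block π t₀ t₁, weight w ≤ b := by
    intro w hw
    by_contra! hc
    have := h.mem z w hc
    rw [Fin.lt_def, hπz] at this
    have := (mem_block.1 hw).2
    omega
  have hwQ : ∀ w ∈ block π t₁ t₂, b ≤ weight w := by
    intro w hw
    by_contra! hc
    have := h.mem w z hc
    rw [Fin.lt_def, hπz] at this
    have := (mem_block.1 hw).1
    omega
  have hcut : IsCut n m t₁ := ⟨ht₁.le, Or.inr (Or.inr h₁)⟩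
  have hK := h.choose_le
  have up := h.card_inter_block_le h₀ hcut h01 (b := b) (by omega) (by omega) hwP hU hK
  have low := h.card_inter_block_ge hcut h₂ h12 (b := b) (by omega) (by omega) hwQ hU hK
  set K : ℝ := 2 ^ n / (320 * m) with hKdef
  have hm0 : (0 : ℝ) < m := by exact_mod_cast hm
  -- The positive density at `weight x ≤ b` persists at `b`, so `U` has a point of weight `b` and
  -- contains its whole neighbourhood in layer `b + 10`. The bound `hup` is dual, starting from `y ∉
  -- U`.
  have hlow : (32 * (n : ℝ) ^ 9) ≤ density U (b + 10) * K := by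
    obtain ⟨w, hwU, hwb⟩ := exists_mem_of_density_pos
      ((density_pos hxU).trans_le (density_mono hU (hwP x hx) (weight_le z)))
    have h1 : nbhd w (b + 10) ⊆ U ∩ layer n (b + 10) := by
      intro v hv
      refine Finset.mem_inter.2 ⟨?_, nbhd_subset _ _ hv⟩
      rw [nbhd_of_lt (by omega), Finset.mem_filter] at hv
      exact hU hv.2 hwU
    have h2 := Finset.card_le_card h1
    rw [card_nbhd_up (by omega)] at h2
    have h3 := (choose_ten_ge hn (by omega : n ≤ 4 * (n - weight w))).trans h2
    calc (32 * (n : ℝ) ^ 9) ≤ (U ∩ layer n (b + 10)).card := by exact_mod_cast h3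
      _ = density U (b + 10) * n.choose (b + 10) := (density_mul U (by omega)).symm
      _ ≤ _ := mul_le_mul_of_nonneg_left (hK _) (density_nonneg U)
  have hup : (32 * (n : ℝ) ^ 9) ≤ (1 - density U (b - 10)) * K := by
    have hpos : 0 < density Uᶜ b := by
      have h1 := density_pos (Finset.mem_compl.2 hyU)
      rw [density_compl U (weight_le y)] at h1
      rw [density_compl U (weight_le z)]
      have := density_mono hU (hwQ y hy) (weight_le y)
      linarith
    obtain ⟨w, hwU, hwb⟩ := exists_mem_of_density_pos hpos
    have h1 : nbhd w (b - 10) ⊆ Uᶜ ∩ layer n (b - 10) := by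
      intro v hv
      refine Finset.mem_inter.2 ⟨?_, nbhd_subset _ _ hv⟩
      rw [nbhd_of_gt (by omega), Finset.mem_filter] at hv
      exact Finset.mem_compl.2 fun hvU => Finset.mem_compl.1 hwU (hU hv.2 hvU)
    have h2 := Finset.card_le_card h1
    rw [card_nbhd_down (by omega)] at h2
    have h3 := (choose_ten_ge hn (by omega : n ≤ 4 * weight w)).trans h2
    calc (32 * (n : ℝ) ^ 9) ≤ (Uᶜ ∩ layer n (b - 10)).card := by exact_mod_cast h3
      _ = density Uᶜ (b - 10) * n.choose (b - 10) := (density_mul _ (by omega)).symm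
      _ ≤ density Uᶜ (b - 10) * K := mul_le_mul_of_nonneg_left (hK _) (density_nonneg _)
      _ = _ := by rw [density_compl U (by omega)]
  have hMM : density U (b - 10) ≤ density U (b + 10) := density_mono hU (by omega) (by omega)
  have hexp : density U (b - 10) * (1 - density U (b - 10)) / (n : ℝ) ^ 2 ≤
      density U (b + 10) - density U (b - 10) := by
    have h1 := density_succ_ge (l := b - 10) hU (by omega)
    have h2 : density U (b - 10 + 1) ≤ density U (b + 10) := density_mono hU (by omega) (by omega)
    linarith
  have hcP := card_block π h01 ht₁.le
  have hcQ := card_block π h12 h₂.1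
  rw [hcP] at up
  rw [hcQ] at low
  have hgain := gain_ge (n := n) (m := m) (k := (t₁ - t₀ : ℕ)) (K := K) (W := 2 ^ n)
    (by exact_mod_cast hm) (by exact_mod_cast hnm) (by exact_mod_cast hk) (by positivity)
    (by rw [hKdef]; field_simp) (density_nonneg U) hMM (density_le_one U) hexp hlow hup
  have hQ : ((t₁ - t₀ : ℕ) : ℝ) * density U (b + 10) ≤ (t₂ - t₁ : ℕ) * density U (b + 10) :=
    mul_le_mul_of_nonneg_right (Nat.cast_le.2 hkk) (density_nonneg U)
  have hfin : ((U ∩ block π t₀ t₁).card : ℝ) + m ≤ (U ∩ block π t₁ t₂).card := by linarith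
  exact_mod_cast hfin

/-! ### Hall's theorem and the matchings between blocks -/

/-- Hall's theorem for monotone matchings, in terms of up-sets. -/
theorem exists_matching_of_upperSet {n : ℕ} {P Q : Finset (Cube n)} (hPQ : Disjoint P Q)
    (hHall : ∀ U : Finset (Cube n), IsUpperSet (U : Set (Cube n)) →
      (U ∩ P).card ≤ (U ∩ Q).card) :
    ∃ E : Finset (Cube n × Cube n), IsMonotoneMatching P Q E ∧ E.image Prod.fst = P ∧
      (E.image Prod.snd).card = P.card := by
  classical
  have hall := (Finset.all_card_le_biUnion_card_iff_exists_injective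
    (fun x : P => Q.filter fun y => (x : Cube n) < y)).1 (by
    intro S
    -- Test the hypothesis on the up-closure of `S`: its points in `Q` are exactly the neighbours of
    -- `S`, with strictness coming from disjointness.
    set U : Finset (Cube n) := Finset.univ.filter fun y => ∃ x ∈ S, (x : Cube n) ≤ y with hUdef
    have hU : IsUpperSet (U : Set (Cube n)) := by
      intro a c hac ha
      simp only [hUdef, Finset.coe_filter, Finset.mem_univ, true_and, Set.mem_ofPred_eq] at ha ⊢
      obtain ⟨x, hx, hxa⟩ := ha
      exact ⟨x, hx, hxa.trans hac⟩
    have h1 : S.card ≤ (U ∩ P).card := by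
      rw [← Finset.card_map (Function.Embedding.subtype _)]
      refine Finset.card_le_card fun x hx => ?_
      rw [Finset.mem_map] at hx
      obtain ⟨⟨x, hxP⟩, hxS, rfl⟩ := hx
      exact Finset.mem_inter.2
        ⟨Finset.mem_filter.2 ⟨Finset.mem_univ _, ⟨x, hxP⟩, hxS, le_rfl⟩, hxP⟩
    refine (h1.trans (hHall U hU)).trans (Finset.card_le_card fun y hy => ?_)
    rw [Finset.mem_inter, hUdef, Finset.mem_filter] at hy
    obtain ⟨⟨-, x, hxS, hxy⟩, hyQ⟩ := hy
    refine Finset.mem_biUnion.2 ⟨x, hxS, Finset.mem_filter.2 ⟨hyQ, lt_of_le_of_ne hxy ?_⟩⟩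
    rintro rfl
    exact Finset.disjoint_left.1 hPQ x.2 hyQ)
  obtain ⟨f, hf, hfQ⟩ := hall
  have hf' : ∀ x : P, f x ∈ Q ∧ (x : Cube n) < f x := fun x => by simpa using hfQ x
  have himage : (Finset.univ.image fun x : P => ((x : Cube n), f x)).image Prod.fst = P := by
    ext x; simp
  refine ⟨Finset.univ.image fun x : P => ((x : Cube n), f x), ⟨?_, ?_, ?_⟩, himage, ?_⟩
  · intro e he
    obtain ⟨x, -, rfl⟩ := Finset.mem_image.1 he
    exact ⟨x.2, hf' x⟩
  · intro e he e' he' hee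
    obtain ⟨x, -, rfl⟩ := Finset.mem_image.1 he
    obtain ⟨x', -, rfl⟩ := Finset.mem_image.1 he'
    rw [Subtype.ext hee]
  · intro e he e' he' hee
    obtain ⟨x, -, rfl⟩ := Finset.mem_image.1 he
    obtain ⟨x', -, rfl⟩ := Finset.mem_image.1 he'
    rw [hf hee]
  · rw [Finset.image_image, Finset.card_image_of_injective _ (by exact hf)]
    simp

/-- The target may omit up to `m` points of the upper block, because the surplus `m` of
`Setting.card_inter_add_le` compensates for them. This handles a last block that stops short of the
end of the cube. -/
theorem Setting.exists_matching {n m t₀ t₁ t₂ : ℕ} {π : Cube n ≃ Fin (2 ^ n)} (h : Setting m π)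
    (h₀ : IsCut n m t₀) (h₁ : InnerCut n m t₁) (h₂ : IsCut n m t₂) (h01 : t₀ ≤ t₁) (h12 : t₁ ≤ t₂)
    (hk : 2 ^ n ≤ 2 * m * (t₁ - t₀)) {Q : Finset (Cube n)}
    (hQ : Q ⊆ block π t₁ t₂) (hQk : t₁ - t₀ ≤ Q.card) (hQm : t₂ - t₁ ≤ Q.card + m) :
    ∃ E : Finset (Cube n × Cube n), IsMonotoneMatching (block π t₀ t₁) Q E ∧
      E.image Prod.fst = block π t₀ t₁ ∧ (E.image Prod.snd).card = t₁ - t₀ := by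
  have hcP := card_block π h01 h₁.lt.le
  have hcQ := card_block π h12 h₂.1
  rw [← hcP]
  refine exists_matching_of_upperSet ?_ fun U hU => ?_
  · refine Finset.disjoint_left.2 fun x hx hxQ => ?_
    have h1 := mem_block.1 hx
    have h2 := mem_block.1 (hQ hxQ)
    omega
  · rcases (U ∩ block π t₀ t₁).eq_empty_or_nonempty with he | ⟨x, hx⟩
    · simp [he]
    by_cases hsub : block π t₁ t₂ ⊆ U
    · rw [Finset.inter_eq_right.2 (hQ.trans hsub)]
      exact (Finset.card_le_card Finset.inter_subset_right).trans (hcP.trans_le hQk)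
    · obtain ⟨y, hy, hyU⟩ := Finset.not_subset.1 hsub
      rw [Finset.mem_inter] at hx
      have h1 := h.card_inter_add_le h₀ h₁ h₂ h01 h12 hk
        (hQk.trans (hcQ ▸ Finset.card_le_card hQ)) hU hx.1 hx.2 hyU hy
      have h2 : (U ∩ block π t₁ t₂).card ≤ (U ∩ Q).card + (block π t₁ t₂ \ Q).card := by
        refine (Finset.card_le_card fun w hw => ?_).trans (Finset.card_union_le _ _)
        rw [Finset.mem_inter] at hw
        rw [Finset.mem_union, Finset.mem_inter, Finset.mem_sdiff]
        by_cases hwQ : w ∈ Q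
        · exact Or.inl ⟨hw.1, hwQ⟩
        · exact Or.inr ⟨hw.2, hwQ⟩
      rw [Finset.card_sdiff_of_subset hQ, hcQ] at h2
      omega

/-! ### The matched family of equal blocks -/

theorem Setting.lt_two_pow {n m : ℕ} {π : Cube n ≃ Fin (2 ^ n)} (h : Setting m π) :
    m < 2 ^ n :=
  lt_of_le_of_lt (by have := h.mul_lt; omega) Nat.lt_two_pow_self

/-- As `2 ^ n / m ≥ 1`, rounding down loses at most a factor two; hence the `2 * m` in `InnerCut`.
-/
theorem Setting.two_pow_le {n m t : ℕ} {π : Cube n ≃ Fin (2 ^ n)} (h : Setting m π)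
    (ht : 2 ^ n / m ≤ t) : 2 ^ n ≤ 2 * m * t := by
  have h1 : 1 ≤ 2 ^ n / m := (Nat.one_le_div_iff h.pos).2 h.lt_two_pow.le
  have h2 := Nat.lt_mul_div_succ (2 ^ n) h.pos
  calc 2 ^ n ≤ m * (2 ^ n / m + 1) := h2.le
    _ ≤ m * (2 * t) := Nat.mul_le_mul_left _ (by omega)
    _ = 2 * m * t := by ring

theorem Setting.innerCut {n m t : ℕ} {π : Cube n ≃ Fin (2 ^ n)} (h : Setting m π)
    (ht : 2 ^ n / m ≤ t) (ht' : t + 2 ^ n / m ≤ 2 ^ n) : InnerCut n m t :=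
  ⟨h.two_pow_le ht, h.two_pow_le (by omega)⟩

theorem chunk_eq_block {n m : ℕ} (π : Cube n ≃ Fin (2 ^ n)) (i : Fin m) :
    chunk m π i = block π (2 ^ n / m * i) (2 ^ n / m * (i + 1)) := by
  ext x
  simp [chunk, mem_block]

theorem weight_le_of_apply_lt {n : ℕ} {π : Cube n ≃ Fin (2 ^ n)} (hπ : π ∈ layerOrderings n)
    {x y : Cube n} (h : (π x : ℕ) < π y) : weight x ≤ weight y := by
  by_contra! hc
  have := hπ y x hc
  rw [Fin.lt_def] at this
  omega

theorem Setting.isMatchedFamily {n m : ℕ} {π : Cube n ≃ Fin (2 ^ n)} (h : Setting m π) :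
    IsMatchedFamily (chunk m π) := by
  set N := 2 ^ n / m with hN
  have hNm : N * m ≤ 2 ^ n := Nat.div_mul_le_self _ _
  have hle : ∀ i : ℕ, i ≤ m → N * i ≤ 2 ^ n := fun i hi => (Nat.mul_le_mul_left N hi).trans hNm
  have hcard : ∀ i : Fin m, (chunk m π i).card = N := fun i => by
    rw [chunk_eq_block, card_block π (Nat.mul_le_mul_left _ (Nat.le_succ _)) (hle _ i.2),
      Nat.mul_succ, Nat.add_sub_cancel_left]
  have hlt : ∀ i j : Fin m, (i : ℕ) < j → ∀ x ∈ chunk m π i, ∀ y ∈ chunk m π j,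
      (π x : ℕ) < π y := fun i j hij x hx y hy => by
    rw [chunk_eq_block, mem_block] at hx hy
    have := Nat.mul_le_mul_left N (Nat.succ_le_of_lt hij)
    exact (hx.2.trans_le this).trans_le hy.1
  refine ⟨?_, hcard, ?_, ?_, ?_⟩
  · intro i j hij
    refine Finset.disjoint_left.2 fun x hx hy => ?_
    rcases lt_or_gt_of_ne (Fin.val_ne_of_ne hij) with h1 | h1
    · exact lt_irrefl _ (hlt i j h1 x hx x hy)
    · exact lt_irrefl _ (hlt j i h1 x hy x hx)
  · intro i j hij x hx y hy
    exact weight_le_of_apply_lt h.mem (hlt i j (by omega) x hx y hy)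
  · intro i x hx y hy
    refine weight_le_of_apply_lt h.mem ?_
    rw [chunk_eq_block, mem_block] at hx
    refine (hx.2.trans_le (Nat.mul_le_mul_left N (Nat.succ_le_of_lt i.2))).trans_le ?_
    by_contra! hc
    have hdiv : (π y : ℕ) / N < m := Nat.div_lt_of_lt_mul hc
    refine hy ⟨_, hdiv⟩ ?_
    rw [chunk_eq_block, mem_block]
    have hN0 : 0 < N := Nat.pos_of_ne_zero fun h0 => by simp [h0] at hc
    exact ⟨Nat.mul_div_le _ _, Nat.lt_mul_div_succ _ hN0⟩
  · intro i j hij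
    have hi := i.2
    have hj := j.2
    have e1 : N * (i + 1) = N * i + N := Nat.mul_succ _ _
    have e2 : N * (j + 1) = N * j + N := Nat.mul_succ _ _
    have hN0 := Nat.zero_le N
    have e3 : N * (j : ℕ) = N * (i + 1) := by rw [hij]
    have hj1 := hle (j + 1) (by omega)
    have hinner : ∀ t : ℕ, 0 < t → t < m → InnerCut n m (N * t) := fun t h0 ht => by
      refine h.innerCut (Nat.le_mul_of_pos_right _ h0) ?_
      have := hle (t + 1) (by omega)
      rwa [Nat.mul_succ] at this
    have hcut₀ : IsCut n m (N * i) := by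
      refine ⟨hle _ hi.le, ?_⟩
      rcases Nat.eq_zero_or_pos (i : ℕ) with h0 | h0
      · left; rw [h0, mul_zero]
      · exact Or.inr (Or.inr (hinner _ h0 hi))
    -- The end of the last chunk may leave fewer than `m` points above it and then is not an
    -- admissible cut. That chunk is therefore embedded in the block running to `2 ^ n`.
    have hsub : chunk m π j ⊆ block π (N * (i + 1)) (if (j : ℕ) + 1 = m then 2 ^ n
        else N * (j + 1)) := by
      intro x hx
      rw [chunk_eq_block, mem_block] at hx
      rw [mem_block]
      refine ⟨by rw [← e3]; exact hx.1, hx.2.trans_le ?_⟩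
      split_ifs
      · exact hj1
      · exact le_rfl
    have hmod := Nat.lt_mul_div_succ (2 ^ n) h.pos
    rw [← hN, Nat.mul_succ, mul_comm m] at hmod
    have hcut₂ : IsCut n m (if (j : ℕ) + 1 = m then 2 ^ n else N * (j + 1)) := by
      split_ifs with hjm
      · exact ⟨le_rfl, Or.inr (Or.inl rfl)⟩
      · exact ⟨hj1, Or.inr (Or.inr (hinner _ (Nat.succ_pos _) (by omega)))⟩
    obtain ⟨E, hE, hfst, hsnd⟩ := h.exists_matching hcut₀ (hinner (i + 1) (Nat.succ_pos _)
      (by omega)) hcut₂ (Nat.mul_le_mul_left _ (Nat.le_succ _))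
      (by split_ifs <;> omega) (h.two_pow_le (by omega)) hsub
      (by rw [hcard]; omega)
      (by
        rw [hcard]
        split_ifs with hjm
        · have : N * m = N * (j + 1) := by rw [hjm]
          omega
        · omega)
    refine ⟨E, by rwa [chunk_eq_block], by rw [hfst, chunk_eq_block], ?_⟩
    refine Finset.eq_of_subset_of_card_le (fun y hy => ?_) ?_
    · obtain ⟨e, he, rfl⟩ := Finset.mem_image.1 hy
      exact (hE.edge e he).2.1
    · rw [hsnd, hcard]; omega

/-! ### Monotone maps with matched classes -/

theorem exists_classMap {n m : ℕ} (hm : 0 < m) {π : Cube n ≃ Fin (2 ^ n)}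
    (hπ : π ∈ layerOrderings n) {c : ℕ → ℕ} (hc : Monotone c) (hc0 : c 0 = 0)
    (hcm : c m = 2 ^ n) :
    ∃ φ : Cube n → Fin m, Monotone φ ∧ ∀ i : Fin m, fiber φ i = block π (c i) (c (i + 1)) := by
  let g : Cube n → ℕ := fun x => Nat.findGreatest (fun i => c i ≤ π x) (m - 1)
  have hg : ∀ x, g x < m := fun x => by
    have := Nat.findGreatest_le (P := fun i => c i ≤ π x) (m - 1)
    simp only [g]
    omega
  have hlow : ∀ x, c (g x) ≤ π x := fun x =>
    Nat.findGreatest_spec (P := fun i => c i ≤ π x) (Nat.zero_le _) (by simp [hc0])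
  have hup : ∀ x, (π x : ℕ) < c (g x + 1) := by
    intro x
    rcases eq_or_lt_of_le (Nat.succ_le_of_lt (hg x)) with h1 | h1
    · rw [← Nat.succ_eq_add_one, h1, hcm]
      exact (π x).2
    · by_contra! h2
      exact Nat.findGreatest_is_greatest (P := fun i => c i ≤ π x) (n := m - 1)
        (Nat.lt_succ_self (g x)) (by omega) h2
  refine ⟨fun x => ⟨g x, hg x⟩, ?_, ?_⟩
  · intro x y hxy
    rcases hxy.eq_or_lt with rfl | hlt
    · exact le_rfl
    have h1 : (π x : ℕ) < π y := hπ x y (weight_strictMono hlt)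
    rw [Fin.mk_le_mk]
    by_contra! h2
    have h3 := hc (Nat.succ_le_of_lt h2)
    have h4 := hlow x
    have h5 := hup y
    simp only [Nat.succ_eq_add_one] at h3
    omega
  · intro i
    ext x
    rw [mem_block]
    simp only [fiber, Finset.mem_filter, Finset.mem_univ, true_and, Fin.ext_iff]
    constructor
    · intro h1
      rw [← h1]
      exact ⟨hlow x, hup x⟩
    · rintro ⟨h1, h2⟩
      have h3 := hlow x
      have h4 := hup x
      by_contra h5
      rcases lt_or_gt_of_ne h5 with h6 | h6
      · have := hc (Nat.succ_le_of_lt h6)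
        simp only [Nat.succ_eq_add_one] at this
        omega
      · have := hc (Nat.succ_le_of_lt h6)
        simp only [Nat.succ_eq_add_one] at this
        omega

/-- Cutting a well-spread ordering into blocks of nondecreasing sizes gives a monotone map whose
classes are matched with as few uncovered points as possible. -/
theorem Setting.exists_map {n m : ℕ} {π : Cube n ≃ Fin (2 ^ n)} (h : Setting m π) {c : ℕ → ℕ}
    (hc : Monotone c) (hc0 : c 0 = 0) (hcm : c m = 2 ^ n)
    (hgap : ∀ i < m, c i + 2 ^ n / m ≤ c (i + 1))
    (hsize : ∀ i, i + 1 < m → c (i + 1) - c i ≤ c (i + 2) - c (i + 1)) :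
    ∃ φ : Cube n → Fin m, Monotone φ ∧ (∀ i : Fin m, fiber φ i = block π (c i) (c (i + 1))) ∧
      (∀ i : Fin m, (fiber φ i).card = c (i + 1) - c i) ∧
      ∀ b : Fin m → ℝ, (∀ i, 0 ≤ b i) →
        (∀ i j : Fin m, (i : ℕ) + 1 = j →
          (((fiber φ j).card - (fiber φ i).card : ℕ) : ℝ) ≤ b j) →
        AdmitsMatchingsMissing φ b := by
  obtain ⟨φ, hφ, hfib⟩ := exists_classMap h.pos h.mem hc hc0 hcm
  have hcle : ∀ i ≤ m, c i ≤ 2 ^ n := fun i hi => hcm ▸ hc hi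
  have hcard : ∀ i : Fin m, (fiber φ i).card = c (i + 1) - c i := fun i => by
    rw [hfib, card_block π (hc (Nat.le_succ _)) (hcle _ i.2)]
  refine ⟨φ, hφ, hfib, hcard, fun b hb0 hb i j hij => ?_⟩
  have hi := i.2
  have hj := j.2
  have hinner : ∀ t, 0 < t → t < m → InnerCut n m (c t) := fun t h0 ht => by
    refine h.innerCut ?_ ((hgap t ht).trans (hcle _ ht))
    have h1 := hgap 0 h.pos
    rw [hc0, zero_add, zero_add] at h1
    exact h1.trans (hc h0)
  have hcut : ∀ t ≤ m, IsCut n m (c t) := fun t ht => by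
    refine ⟨hcle t ht, ?_⟩
    rcases Nat.eq_zero_or_pos t with rfl | h0
    · exact Or.inl hc0
    rcases ht.eq_or_lt with rfl | h1
    · exact Or.inr (Or.inl hcm)
    · exact Or.inr (Or.inr (hinner t h0 h1))
  have hs := hsize i (by omega)
  have hgi := hgap i hi
  have hcj : (block π (c (i + 1)) (c (i + 2))).card = c (i + 2) - c (i + 1) :=
    card_block π (hc (Nat.le_succ _)) (hcle _ (by omega))
  obtain ⟨E, hE, hfst, hsnd⟩ := h.exists_matching (hcut i hi.le) (hinner (i + 1) (Nat.succ_pos _)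
    (by omega)) (hcut (i + 2) (by omega)) (hc (Nat.le_succ _)) (hc (Nat.le_succ _))
    (h.two_pow_le (by omega)) subset_rfl (by rw [hcj]; exact hs) (by rw [hcj]; omega)
  have hfj : fiber φ j = block π (c (i + 1)) (c (i + 2)) := by rw [hfib j, ← hij]
  refine ⟨E, by rwa [hfib i, hfj], ?_, ?_⟩
  · rw [hfst, hfib i, Finset.sdiff_self]
    simpa using hb0 i
  · have hsub : E.image Prod.snd ⊆ fiber φ j := fun y hy => by
      obtain ⟨e, he, rfl⟩ := Finset.mem_image.1 hy
      rw [hfj]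
      exact (hE.edge e he).2.1
    rw [Finset.card_sdiff_of_subset hsub, hsnd, ← hcard i]
    exact hb i j hij

theorem Setting.exists_almostPerfect {n m : ℕ} {π : Cube n ≃ Fin (2 ^ n)} (h : Setting m π) :
    ∃ φ : Cube n → Fin m, Monotone φ ∧ AdmitsAlmostPerfectMatching ((m : ℝ) / 2 ^ n) φ := by
  set q := 2 ^ n / m with hq
  set s := 2 ^ n % m with hs
  have hq0 := Nat.zero_le q
  have hsm : s < m := Nat.mod_lt _ h.pos
  have hdiv : q * m + s = 2 ^ n := by rw [mul_comm]; exact Nat.div_add_mod _ _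
  have hstep : ∀ i, q * (i + 1) = q * i + q := fun i => Nat.mul_succ _ _
  have hm0 : (0 : ℝ) < m := by exact_mod_cast h.pos
  -- With truncated subtraction, the first `m - s` blocks have size `q` and the last `s` have size
  -- `q + 1`, so the sizes are nondecreasing and fill the cube.
  obtain ⟨φ, hφ, -, hcard, hadm⟩ := h.exists_map (c := fun i => q * i + (i + s - m))
    (monotone_nat_of_le_succ fun i => by have := hstep i; omega) (by simp [hsm.le])
    (by simpa using hdiv) (fun i hi => by have := hstep i; omega)
    (fun i hi => by
      have h1 := hstep i
      have h2 := hstep (i + 1)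
      rw [add_assoc] at h2
      simp only [Nat.reduceAdd] at h2
      omega)
  refine ⟨φ, hφ, hadm _ (fun i => by positivity) fun i j hij => ?_⟩
  have h1 := hstep i
  have h2 := hstep j
  have h3 : q * (j : ℕ) = q * (i + 1) := by rw [hij]
  have hci := hcard i
  have hcj := hcard j
  rcases Nat.eq_zero_or_pos ((fiber φ j).card - (fiber φ i).card) with h0 | h0
  · rw [h0, Nat.cast_zero]
    positivity
  -- A point is missed only when the size jumps from `q` to `q + 1`, and then `δ * (q + 1) ≥ 1` for
  -- `δ = m / 2 ^ n`.
  · have hj1 : (fiber φ j).card = q + 1 := by omega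
    have hd : (fiber φ j).card - (fiber φ i).card = 1 := by omega
    rw [hd, hj1, div_mul_eq_mul_div, le_div_iff₀ (by positivity), Nat.cast_one, one_mul]
    have : 2 ^ n ≤ m * (q + 1) := (Nat.lt_mul_div_succ _ h.pos).le
    exact_mod_cast this

theorem Setting.exists_chunkMap {n m : ℕ} {π : Cube n ≃ Fin (2 ^ n)} (h : Setting m π) :
    ∃ φ : Cube n → Fin m,
      (∀ i : Fin m, ∀ x ∈ chunk m π i, φ x = i) ∧
      (∀ x : Cube n, (∀ i : Fin m, x ∉ chunk m π i) → (φ x : ℕ) + 1 = m) ∧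
      Monotone φ ∧
      AdmitsMatchingsMissing φ (fun i => if (i : ℕ) + 1 = m then (m : ℝ) - 1 else 0) := by
  set q := 2 ^ n / m with hq
  have hm := h.pos
  have hq0 := Nat.zero_le q
  have hqm : q * m ≤ 2 ^ n := Nat.div_mul_le_self _ _
  have hlt : 2 ^ n < q * m + m := by
    have := Nat.lt_mul_div_succ (2 ^ n) hm
    rwa [Nat.mul_succ, mul_comm] at this
  have hstep : ∀ i, q * (i + 1) = q * i + q := fun i => Nat.mul_succ _ _
  have hle : ∀ i, i ≤ m → q * i ≤ q * m := fun i hi => Nat.mul_le_mul_left q hi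
  -- All leftover points, at most `m - 1`, go to the last class.
  let c : ℕ → ℕ := fun i => if i < m then q * i else 2 ^ n
  have hclt : ∀ i, i < m → c i = q * i := fun i hi => if_pos hi
  have hcge : ∀ i, m ≤ i → c i = 2 ^ n := fun i hi => if_neg (by omega)
  have hcle : ∀ i, i ≤ m → q * i ≤ c i := fun i hi => by
    rcases hi.eq_or_lt with rfl | h1
    · rw [hcge _ le_rfl]; exact hqm
    · rw [hclt i h1]
  have hgap : ∀ i < m, c i + q ≤ c (i + 1) := fun i hi => by
    have h1 := hcle (i + 1) hi
    rw [hclt i hi]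
    have := hstep i
    omega
  obtain ⟨φ, hφ, hfib, hcard, hadm⟩ := h.exists_map (c := c)
    (monotone_nat_of_le_succ fun i => by
      rcases lt_or_ge i m with hi | hi
      · have := hgap i hi
        omega
      · rw [hcge i hi, hcge (i + 1) (by omega)])
    (by rw [hclt 0 hm, mul_zero]) (hcge m le_rfl) hgap
    (fun i hi => by
      have h1 := hgap (i + 1) hi
      have h2 := hclt i (by omega)
      have h3 := hclt (i + 1) hi
      have h4 := hstep i
      simp only [add_assoc, Nat.reduceAdd] at h1
      omega)
  refine ⟨φ, ?_, ?_, hφ, hadm _ ?_ ?_⟩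
  · intro i x hx
    have h1 : x ∈ fiber φ i := by
      rw [chunk_eq_block, mem_block] at hx
      rw [hfib i, mem_block, hclt i i.2]
      exact ⟨hx.1, hx.2.trans_le (hcle _ i.2)⟩
    exact (Finset.mem_filter.1 h1).2
  · intro x hx
    by_contra hne
    have hlt' : (φ x : ℕ) + 1 < m := by have := (φ x).2; omega
    refine hx (φ x) ?_
    have h1 : x ∈ fiber φ (φ x) := Finset.mem_filter.2 ⟨Finset.mem_univ _, rfl⟩
    rw [hfib, hclt _ (φ x).2, hclt _ hlt'] at h1
    rwa [chunk_eq_block]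
  · intro i
    split_ifs
    · have : (1 : ℝ) ≤ m := by exact_mod_cast hm
      linarith
    · exact le_rfl
  · intro i j hij
    have hi := i.2
    have hj := j.2
    rw [hcard i, hcard j, ← hij, hclt i hi, hclt (i + 1) (by omega)]
    have h1 := hstep i
    have h2 := hstep (i + 1)
    split_ifs with hjm
    · rw [hcge (i + 1 + 1) (by omega), le_sub_iff_add_le]
      have h3 : q * m = q * (i + 1 + 1) := by rw [hjm]
      exact_mod_cast (by omega :
        2 ^ n - q * (i + 1) - (q * (i + 1) - q * i) + 1 ≤ m)
    · rw [hclt (i + 1 + 1) (by omega)]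
      have h3 : q * ((i : ℕ) + 1 + 1) - q * (i + 1) - (q * (i + 1) - q * i) = 0 := by omega
      rw [h3, Nat.cast_zero]

end CubeMatching

/-! ### Assembly of the main theorem -/

theorem mainTheorem5 :
    ∃ C : ℝ, 0 < C ∧ ∃ η : ℕ → ℝ, Tendsto η atTop (𝓝 0) ∧
      ∀ m r : ℕ, 0 < m → C * (m : ℝ) ^ 6 ≤ (r : ℝ) →
        -- a monotone map with a `δ`-almost perfect matching, `δ ≤ m * 2 ^ (-r)`
        (∃ φ : CubeMatching.Cube r → Fin m, Monotone φ ∧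
          ∃ δ : ℝ, 0 < δ ∧ δ ≤ (m : ℝ) / 2 ^ r ∧
            CubeMatching.AdmitsAlmostPerfectMatching δ φ) ∧
        -- the sets `P_1, …, P_m`, which are blocks of a layer ordering, and their map `φ`
        (∃ P : Fin m → Finset (CubeMatching.Cube r),
          (∃ π ∈ CubeMatching.layerOrderings r, P = CubeMatching.chunk m π) ∧
          CubeMatching.IsMatchedFamily P ∧
          ∃ φ : CubeMatching.Cube r → Fin m,
            (∀ i : Fin m, ∀ x ∈ P i, φ x = i) ∧
            (∀ x : CubeMatching.Cube r, (∀ i : Fin m, x ∉ P i) → (φ x : ℕ) + 1 = m) ∧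
            Monotone φ ∧
            CubeMatching.AdmitsMatchingsMissing φ
              (fun i => if (i : ℕ) + 1 = m then (m : ℝ) - 1 else 0)) ∧
        -- a uniformly random layer ordering works with probability at least `1 - η r`
        (1 - η r) * ((CubeMatching.layerOrderings r).ncard : ℝ) ≤
          (({π ∈ CubeMatching.layerOrderings r |
            CubeMatching.IsMatchedFamily (CubeMatching.chunk m π)}).ncard : ℝ) := by
  classical
  -- The constant covers both `2 ^ 60 ≤ r` and `(320 * m) ^ 2 ≤ r`; the latter needs only `m ^ 2 ≤ m
  -- ^ 6`. The failure probability is that of not being well spread, an event independent of `m`.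
  refine ⟨2 ^ 60, by positivity, fun r => (1 / 2) ^ r,
    tendsto_pow_atTop_nhds_zero_of_lt_one (by norm_num) (by norm_num), fun m r hm hr => ?_⟩
  have hr' : 2 ^ 60 * m ^ 6 ≤ r := by exact_mod_cast hr
  have h26 : m ^ 2 ≤ m ^ 6 := Nat.pow_le_pow_right hm (by norm_num)
  have h06 : 1 ≤ m ^ 6 := Nat.one_le_pow _ _ hm
  have hlarge : 2 ^ 60 ≤ r := by omega
  have hparam : (320 * m) ^ 2 ≤ r := by
    rw [mul_pow]
    omega
  have hbad := CubeMatching.card_not_wellSpread_le (n := r) (by omega)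
  have hsplit := Finset.card_filter_add_card_filter_not (s := CubeMatching.layerOrderingsFinset r)
    CubeMatching.WellSpread
  have hgood : (1 - (1 / 2 : ℝ) ^ r) * (CubeMatching.layerOrderingsFinset r).card ≤
      ((CubeMatching.layerOrderingsFinset r).filter CubeMatching.WellSpread).card := by
    have : ((((CubeMatching.layerOrderingsFinset r).filter CubeMatching.WellSpread).card : ℕ) : ℝ) +
        (((CubeMatching.layerOrderingsFinset r).filter
          fun π => ¬ CubeMatching.WellSpread π).card : ℕ) =
        (CubeMatching.layerOrderingsFinset r).card := by exact_mod_cast hsplit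
    linarith
  have hset : ∀ π ∈ (CubeMatching.layerOrderingsFinset r).filter CubeMatching.WellSpread,
      CubeMatching.Setting m π := fun π hπ => by
    rw [Finset.mem_filter, CubeMatching.mem_layerOrderingsFinset] at hπ
    exact ⟨hπ.1, hπ.2, hlarge, hm, hparam⟩
  -- A positive proportion of good orderings gives the single one used for the first two claims.
  obtain ⟨π, hπ⟩ : ((CubeMatching.layerOrderingsFinset r).filter
      CubeMatching.WellSpread).Nonempty := by
    rw [← Finset.card_pos]
    obtain ⟨π₀, hπ₀⟩ := CubeMatching.layerOrderings_nonempty r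
    have h1 : 0 < (CubeMatching.layerOrderingsFinset r).card :=
      Finset.card_pos.2 ⟨π₀, CubeMatching.mem_layerOrderingsFinset.2 hπ₀⟩
    have h2 : (1 / 2 : ℝ) ^ r < 1 := pow_lt_one₀ (by norm_num) (by norm_num) (by omega)
    have h3 : (0 : ℝ) < (1 - (1 / 2 : ℝ) ^ r) * (CubeMatching.layerOrderingsFinset r).card :=
      mul_pos (by linarith) (by exact_mod_cast h1)
    exact_mod_cast h3.trans_le hgood
  have hS := hset π hπ
  refine ⟨?_, ?_, ?_⟩
  · obtain ⟨φ, hφ, hadm⟩ := hS.exists_almostPerfect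
    have hm0 : (0 : ℝ) < m := by exact_mod_cast hm
    exact ⟨φ, hφ, _, by positivity, le_rfl, hadm⟩
  · exact ⟨CubeMatching.chunk m π, ⟨π, hS.mem, rfl⟩, hS.isMatchedFamily, hS.exists_chunkMap⟩
  · rw [CubeMatching.ncard_layerOrderings]
    refine hgood.trans ?_
    rw [← Set.ncard_coe_finset]
    refine Nat.cast_le.2 (Set.ncard_le_ncard (fun π hπ => ?_) (Set.toFinite _))
    have h1 := hset π hπ
    exact ⟨h1.mem, h1.isMatchedFamily⟩
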